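/- **Setting.** Let $(\mathcal S,\mathcal A,\nu_0,P,\gamma)$ be an infinite-horizon Markov decision process with discount $\gamma\in(0,1)$, and let $\phi:\mathcal S\times\mathcal A\to\mathbb R^d$, $d\ge 1$, be a measurable feature map with $\|\phi(s,a)\|\le L$. Write $H_\gamma=(1-\gamma)^{-1}$. For a trajectory $\tau=(s_0,a_0,s_1,\dots)$ let $\phi(\tau)=\sum_{h\ge0}\gamma^h\phi(s_h,a_h)$. For a stationary Markov policy $\pi$ let $\mathbb P_\pi$ be the law of its trajectory, $V_\theta^\pi=\mathbb E_{\tau\sim\mathbb P_\pi}\big[\sum_{h\ge 0}\gamma^h\langle\theta,\phi(s_h,a_h)\rangle\big]$ and $V_\theta^*=\sup_\pi V_\theta^\pi$. The true reward parameter $\theta^*\in\mathbb R^d$ satisfies $\|\theta^*\|\le B$, and $\mathsf{SubOpt}(\pi)=V^*_{\theta^*}-V^\pi_{\theta^*}$. Preferences follow the Bradley–Terry model: a query on $(\tau,\tau')$ returns $y=1$ with probability $\sigma(\langle\theta^*,\phi(\tau)-\phi(\tau')\rangle)$ and $y=0$ otherwise, where $\sigma(x)=1/(1+e^{-x})$.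 Let $\kappa=\max\{1/\sigma'(\langle\theta,x\rangle):\|\theta\|\le B,\ \|x\|\le 2LH_\gamma\}$. A PAC-RL oracle is a randomized algorithm that for every $\varepsilon>0$, $\delta\in(0,1)$, $\theta\in\mathbb R^d$ returns a policy $\pi=\mathtt A(\theta,\varepsilon,\delta)$ with $V_\theta^*-V_\theta^\pi\le\varepsilon$ with probability at least $1-\delta$. **Algorithm (RPO-Explore).** Input: $T\ge1$, $\delta\in(0,1)$, $\lambda>0$. Put $\varepsilon=1/\sqrt T$, $\delta'=\delta/5$, $V_1=\lambda I$, and choose any policy $\pi_0$. For $t=1,\dots,T$: sample $\tilde\theta_t\sim\mathcal N(0,V_t^{-1})$; call the oracle, $\pi_t=\mathtt A(\tilde\theta_t,\varepsilon,\delta'/T)$; sample $\tau_t\sim\mathbb P_{\pi_t}$ and $\tau'_t\sim\mathbb P_{\pi_{t-1}}$; put $x_t=\phi(\tau_t)-\phi(\tau_t')$ and $V_{t+1}=V_t+x_tx_t^\top$. No preference is queried during these $T$ rounds. Then query, in a single batch, one preference label $y_t$ for each stored pair $(\tau_t,\tau_t')$, take any $\hat\theta\in\arg\min_{\|\theta\|\le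 B}-\sum_{t=1}^T\big[y_t\log\sigma(\langle\theta,x_t\rangle)+(1-y_t)\log\sigma(-\langle\theta,x_t\rangle)\big]$, and output $\hat\pi=\mathtt A(\hat\theta,\varepsilon,\delta')$. **Theorem.** Write $\log_+x=\max\{1,\log x\}$ and $K=(1+\sqrt\lambda\,B)\,(1+LH_\gamma/\sqrt\lambda)^2$. There is a universal constant $C>0$ such that, in the above setting, for all $\delta\in(0,1)$, $T\ge1$ and $\lambda>0$: 1. with probability at least $1-\delta$, $$\mathsf{SubOpt}(\hat\pi)\le C\,K\,\sqrt{\frac{\kappa d^3}{T}\,\log_+\!\Big(\frac{dT}{\delta}\Big)^3};$$ 2. for every $\eta>0$, if $T\ge C\,N\,\log_+(dN/\delta)^3$ with $N=K^2\kappa d^3/\eta^2$, then $\mathsf{SubOpt}(\hat\pi)\le\eta$ with probability at least $1-\delta$; that is, $\tilde{\mathcal O}(\kappa d^3/\eta^2)$ iterations suffice for an $\eta$-optimal policy. -/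

import Mathlib

open MeasureTheory ProbabilityTheory
open scoped ENNReal Matrix

namespace RPO

noncomputable section

/-- The parameter and feature space `ℝ^d` with its Euclidean norm and standard inner product. -/
abbrev E (d : ℕ) : Type := EuclideanSpace ℝ (Fin d)

/-- Trajectories `(s₀, a₀, s₁, a₁, …)`. -/
abbrev Traj (S A : Type*) : Type _ := ℕ → S × A

/-! ### The Markov decision process and its value functions -/

/-- An infinite-horizon discounted Markov decision process (without reward) with a feature map. -/
structure FeatureMDP (S A : Type*) [MeasurableSpace S] [MeasurableSpace A] (d : ℕ) where
  /-- initial state distribution -/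
  init : Measure S
  /-- transition law -/
  trans : Kernel (S × A) S
  /-- discount rate -/
  γ : ℝ
  /-- feature map -/
  φ : S × A → E d
  isProbabilityMeasure_init : IsProbabilityMeasure init
  isMarkovKernel_trans : IsMarkovKernel trans
  γ_pos : 0 < γ
  γ_lt_one : γ < 1
  measurable_φ : Measurable φ

attribute [instance] FeatureMDP.isProbabilityMeasure_init FeatureMDP.isMarkovKernel_trans

/-- A stationary Markov policy: a measurable assignment of a law on actions to each state. -/
structure Policy (S A : Type*) [MeasurableSpace S] [MeasurableSpace A] where
  kernel : Kernel S A
  isMarkovKernel_kernel : IsMarkovKernel kernel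

attribute [instance] Policy.isMarkovKernel_kernel

section MDP

variable {S A : Type*} [MeasurableSpace S] [MeasurableSpace A] {d : ℕ}

namespace FeatureMDP

variable (M : FeatureMDP S A d)

/-- The effective horizon `H_γ = 1 / (1 - γ)`. -/
def horizon : ℝ := (1 - M.γ)⁻¹

/-- One step of the state-action chain under `π`: `s' ∼ P(· | s, a)`, then `a' ∼ π(· | s')`. -/
def stepKernel (π : Policy S A) : Kernel (S × A) (S × A) :=
  M.trans ⊗ₖ (π.kernel.comap Prod.snd measurable_snd)

instance (π : Policy S A) : IsMarkovKernel (M.stepKernel π) := by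
  unfold stepKernel; infer_instance

/-- Law of `(s₀, a₀)` under `π`. -/
def initLaw (π : Policy S A) : Measure (S × A) := M.init ⊗ₘ π.kernel

instance (π : Policy S A) : IsProbabilityMeasure (M.initLaw π) := by
  unfold initLaw; infer_instance

/-- The step kernel, viewed as a kernel from the history up to time `n`. -/
def histKernel (π : Policy S A) (n : ℕ) :
    Kernel ((i : Finset.Iic n) → (fun _ : ℕ => S × A) i) (S × A) :=
  (M.stepKernel π).comap (fun h => h ⟨n, Finset.mem_Iic.2 le_rfl⟩) (measurable_pi_apply _)

instance (π : Policy S A) (n : ℕ) : IsMarkovKernel (M.histKernel π n) := by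
  unfold histKernel; infer_instance

/-- The law `ℙ_π` of the trajectory generated by the policy `π` (Ionescu-Tulcea). -/
def trajLaw (π : Policy S A) : Measure (Traj S A) :=
  Kernel.trajMeasure (X := fun _ : ℕ => S × A) (M.initLaw π) (M.histKernel π)

instance (π : Policy S A) : IsProbabilityMeasure (M.trajLaw π) := by
  unfold trajLaw; infer_instance

/-- Discounted sum of features `φ(τ) = ∑ₕ γ^h φ(sₕ, aₕ)` of a trajectory. -/
def trajFeature (τ : Traj S A) : E d := ∑' h : ℕ, M.γ ^ h • M.φ (τ h)

/-- The value `V_θ^π = 𝔼_π [∑ₕ γ^h ⟨θ, φ(sₕ, aₕ)⟩]`. -/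
def value (θ : E d) (π : Policy S A) : ℝ :=
  ∫ τ, ∑' h : ℕ, M.γ ^ h * inner ℝ θ (M.φ (τ h)) ∂(M.trajLaw π)

/-- The optimal value `V_θ^*`, the supremum over all stationary Markov policies. -/
def optValue (θ : E d) : ℝ := ⨆ π : Policy S A, M.value θ π

/-- The suboptimality `V_{θ}^* - V_{θ}^π`. -/
def subOpt (θ : E d) (π : Policy S A) : ℝ := M.optValue θ - M.value θ π

lemma measurable_trajFeature : Measurable M.trajFeature := by
  unfold trajFeature
  refine Measurable.tsum fun h => ?_
  have hm : Measurable fun τ : Traj S A => M.φ (τ h) :=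
    M.measurable_φ.comp (measurable_pi_apply h)
  exact hm.const_smul (M.γ ^ h)

end FeatureMDP

end MDP

/-! ### Measurable families of policies and the RL oracle -/

section Family

variable {S A Pol : Type*} [MeasurableSpace S] [MeasurableSpace A] [MeasurableSpace Pol] {d : ℕ}

/-- A family of policies `(π_p)` indexed by a measurable space `Pol` of policy representations is
a Markov kernel `Pol × S → A`; this is its member with index `p`. -/
def polAt (pol : Kernel (Pol × S) A) [IsMarkovKernel pol] (p : Pol) : Policy S A where
  kernel := pol.comap (Prod.mk p) measurable_prodMk_left
  isMarkovKernel_kernel := inferInstance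

variable (M : FeatureMDP S A d) (pol : Kernel (Pol × S) A) [IsMarkovKernel pol]

/-- Law of `(s₀, a₀)`, jointly in the policy representation. -/
lemma measurable_initLaw : Measurable fun p => M.initLaw (polAt pol p) := by
  have : (fun p => M.initLaw (polAt pol p)) = ⇑((Kernel.const Pol M.init) ⊗ₖ pol) := by
    ext1 p
    rw [Kernel.compProd_apply_eq_compProd_sectR]
    rfl
  rw [this]
  exact Kernel.measurable _

/-- The history kernels, jointly in the policy representation. -/
def jointHistKernel (n : ℕ) :
    Kernel (Pol × ((i : Finset.Iic n) → (fun _ : ℕ => S × A) i)) (S × A) :=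
  (M.trans.comap (fun q => q.2 ⟨n, Finset.mem_Iic.2 le_rfl⟩)
      ((measurable_pi_apply _).comp measurable_snd)) ⊗ₖ
    (pol.comap (fun q => (q.1.1, q.2)) (by fun_prop))

lemma jointHistKernel_sectR (n : ℕ) (p : Pol) :
    (jointHistKernel M pol n).sectR p = M.histKernel (polAt pol p) n := by
  ext1 h
  change _ = M.stepKernel (polAt pol p) (h ⟨n, Finset.mem_Iic.2 le_rfl⟩)
  rw [Kernel.sectR_apply, jointHistKernel, Kernel.compProd_apply_eq_compProd_sectR,
    FeatureMDP.stepKernel, Kernel.compProd_apply_eq_compProd_sectR]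
  rfl

instance (n : ℕ) : IsMarkovKernel (jointHistKernel M pol n) := by
  unfold jointHistKernel; infer_instance

open Preorder in
lemma measurable_marginal (n : ℕ) :
    Measurable fun p => (M.trajLaw (polAt pol p)).map (frestrictLe n) := by
  induction n with
  | zero =>
    have h : ∀ p, (M.trajLaw (polAt pol p)).map (frestrictLe 0)
        = (M.initLaw (polAt pol p)).map
          (MeasurableEquiv.piUnique (fun i : Finset.Iic 0 => (fun _ : ℕ => S × A) i)).symm := by
      intro p
      rw [FeatureMDP.trajLaw, Kernel.trajMeasure, Measure.map_comp _ _ (by fun_prop),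
        Kernel.traj_map_frestrictLe, Kernel.partialTraj_self, Measure.id_comp]
    simp_rw [h]
    exact (Measure.measurable_map _ (MeasurableEquiv.measurable _)).comp (measurable_initLaw M pol)
  | succ n ih =>
    let Q : Kernel Pol ((i : Finset.Iic n) → (fun _ : ℕ => S × A) i) := ⟨_, ih⟩
    have : IsMarkovKernel Q := ⟨fun p => by
      change IsProbabilityMeasure ((M.trajLaw (polAt pol p)).map (frestrictLe n))
      exact Measure.isProbabilityMeasure_map (by fun_prop)⟩
    let g : ((i : Finset.Iic n) → (fun _ : ℕ => S × A) i) × (S × A) →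
        ((i : Finset.Iic (n + 1)) → (fun _ : ℕ => S × A) i) :=
      fun q i => if h : i.1 ≤ n then q.1 ⟨i.1, Finset.mem_Iic.2 h⟩ else q.2
    have hg : Measurable g := by
      refine measurable_pi_lambda _ fun i => ?_
      by_cases h : i.1 ≤ n
      · simp only [g, h, dite_true]
        exact (measurable_pi_apply _).comp measurable_fst
      · simp only [g, h, dite_false]
        exact measurable_snd
    have key : (fun p => (M.trajLaw (polAt pol p)).map (frestrictLe (n + 1)))
        = fun p => ((Q ⊗ₖ jointHistKernel M pol n) p).map g := by
      ext1 p
      rw [Kernel.compProd_apply_eq_compProd_sectR, jointHistKernel_sectR]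
      change _ = (((Kernel.trajMeasure (X := fun _ : ℕ => S × A) _ _).map (frestrictLe n)) ⊗ₘ _).map g
      rw [Kernel.map_frestrictLe_trajMeasure_compProd_eq_map_trajMeasure,
        Measure.map_map hg (by fun_prop)]
      rw [FeatureMDP.trajLaw]
      congr 1
      ext1 x
      ext1 i
      by_cases h : i.1 ≤ n
      · simp [g, h]
      · have : i.1 = n + 1 := by
          have := Finset.mem_Iic.1 i.2
          omega
        simp [g, this]
    rw [key]
    exact (Measure.measurable_map _ hg).comp (Kernel.measurable _)

lemma measurable_trajLaw : Measurable fun p => M.trajLaw (polAt pol p) := by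
  apply Measure.measurable_of_measurable_coe
  refine MeasurableSpace.induction_on_inter
    (C := fun t _ => Measurable (fun p => M.trajLaw (polAt pol p) t))
    (s := measurableCylinders (fun _ : ℕ => S × A)) generateFrom_measurableCylinders.symm
    isPiSystem_measurableCylinders (by simp) (fun t ht => ?_) (fun t mt ht => ?_)
    (fun f disf mf hf => ?_)
  · obtain ⟨N, U, mU, rfl⟩ : ∃ N U, MeasurableSet U ∧ t = cylinder (Finset.Iic N) U := by
      simpa [measurableCylinders_nat] using ht
    have h := Measure.measurable_measure.1 (measurable_marginal M pol N) U mU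
    have e : (fun p => (M.trajLaw (polAt pol p)).map (Preorder.frestrictLe N) U)
        = fun p => M.trajLaw (polAt pol p) (cylinder (Finset.Iic N) U) := by
      ext1 p
      exact Measure.map_apply (Preorder.measurable_frestrictLe N) mU
    exact e ▸ h
  · simpa [measure_compl mt (measure_ne_top _ _)] using Measurable.const_sub ht _
  · simpa [measure_iUnion disf mf] using Measurable.tsum hf

/-- Sampling a trajectory `τ ∼ ℙ_{π_p}`, as a kernel in the policy representation `p`. -/
def trajKernel : Kernel Pol (Traj S A) where
  toFun p := M.trajLaw (polAt pol p)
  measurable' := measurable_trajLaw M pol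

instance : IsMarkovKernel (trajKernel M pol) :=
  ⟨fun p => inferInstanceAs (IsProbabilityMeasure (M.trajLaw (polAt pol p)))⟩

/-- A PAC-RL oracle: a randomized map `(θ, ε, δ) ↦ π` such that for every `ε > 0`, `δ ∈ (0,1)` and
`θ ∈ ℝ^d` the returned policy is `ε`-optimal for the reward parameter `θ` with probability at
least `1 - δ`. -/
def IsPACOracle (oracle : ℝ → ℝ → Kernel (E d) Pol) : Prop :=
  ∀ ε : ℝ, 0 < ε → ∀ δ : ℝ, 0 < δ → δ < 1 → ∀ θ : E d,
    ENNReal.ofReal (1 - δ) ≤ oracle ε δ θ {p | M.subOpt θ (polAt pol p) ≤ ε}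

end Family

/-! ### Maximum likelihood estimation from preference labels -/

section Estimation

variable {d : ℕ}

/-- Negative log-likelihood of the Bradley-Terry model for labelled design points `(xᵢ, yᵢ)`:
`-∑ᵢ [yᵢ log σ(⟨θ, xᵢ⟩) + (1 - yᵢ) log σ(-⟨θ, xᵢ⟩)]`. -/
def negLogLik {T : ℕ} (D : Fin T → E d × Bool) (θ : E d) : ℝ :=
  -∑ i, if (D i).2 then Real.log (Real.sigmoid (inner ℝ θ (D i).1))
    else Real.log (Real.sigmoid (-inner ℝ θ (D i).1))

/-- `θ` minimizes the negative log-likelihood over the closed ball of radius `B`. -/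
def IsMLE {T : ℕ} (B : ℝ) (D : Fin T → E d × Bool) (θ : E d) : Prop :=
  ‖θ‖ ≤ B ∧ ∀ θ' : E d, ‖θ'‖ ≤ B → negLogLik D θ ≤ negLogLik D θ'

/-- `κ = max_{‖θ‖ ≤ B, ‖x‖ ≤ R} 1 / σ'(⟨θ, x⟩)`. -/
def kappa (d : ℕ) (B R : ℝ) : ℝ :=
  sSup {r | ∃ θ x : E d, ‖θ‖ ≤ B ∧ ‖x‖ ≤ R ∧ r = 1 / deriv Real.sigmoid (inner ℝ θ x)}

/-- `log₊ x = max {1, log x}`. -/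
def logPlus (x : ℝ) : ℝ := max 1 (Real.log x)

/-- The polynomial dependence on the problem parameters `B`, `L`, `H_γ` and on the regularization
`λ` of the factor hidden in the `O`-notation. -/
def problemFactor (B L H lam : ℝ) : ℝ := (1 + √lam * B) * (1 + L * H / √lam) ^ 2

end Estimation

/-! ### The algorithm RPO-Explore -/

section Algorithm

variable {S A Pol : Type*} [MeasurableSpace S] [MeasurableSpace A] [MeasurableSpace Pol] {d : ℕ}

/-- The trajectory pairs `(τ_k, τ'_k)` stored during `t` rounds of exploration. -/
abbrev Buffer (S A : Type*) (t : ℕ) : Type _ := Fin t → Traj S A × Traj S A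

variable (M : FeatureMDP S A d)

/-- The design point `x = φ(τ) - φ(τ')`. -/
def designPoint (z : Traj S A × Traj S A) : E d := M.trajFeature z.1 - M.trajFeature z.2

lemma measurable_designPoint : Measurable (designPoint M) :=
  (M.measurable_trajFeature.comp measurable_fst).sub (M.measurable_trajFeature.comp measurable_snd)

/-- The design matrix `V = λ I + ∑_k x_k x_kᵀ`. -/
def designMatrix (lam : ℝ) {t : ℕ} (b : Buffer S A t) : Matrix (Fin d) (Fin d) ℝ :=
  lam • (1 : Matrix (Fin d) (Fin d) ℝ) +
    ∑ k, Matrix.vecMulVec (designPoint M (b k)).ofLp (designPoint M (b k)).ofLp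

/-- The Borel structure on matrices (entrywise). -/
instance instMeasurableSpaceMatrix : MeasurableSpace (Matrix (Fin d) (Fin d) ℝ) :=
  inferInstanceAs (MeasurableSpace (Fin d → Fin d → ℝ))

instance instBorelSpaceMatrix : BorelSpace (Matrix (Fin d) (Fin d) ℝ) :=
  inferInstanceAs (BorelSpace (Fin d → Fin d → ℝ))

lemma measurable_designMatrix (lam : ℝ) {t : ℕ} :
    Measurable (designMatrix M lam : Buffer S A t → Matrix (Fin d) (Fin d) ℝ) := by
  refine measurable_pi_lambda _ fun i => measurable_pi_lambda _ fun j => ?_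
  simp only [designMatrix, Matrix.add_apply, Matrix.sum_apply, Matrix.vecMulVec_apply]
  refine measurable_const.add (Finset.measurable_sum _ fun k _ => ?_)
  have h : Measurable fun b : Buffer S A t => designPoint M (b k) :=
    (measurable_designPoint M).comp (measurable_pi_apply k)
  have hi : ∀ i : Fin d, Measurable fun b : Buffer S A t => (designPoint M (b k)).ofLp i :=
    fun i => (EuclideanSpace.proj (𝕜 := ℝ) i).continuous.measurable.comp h
  exact (hi i).mul (hi j)

lemma measurable_matrix_inv :
    Measurable fun V : Matrix (Fin d) (Fin d) ℝ => V⁻¹ := by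
  have hdet : Measurable fun V : Matrix (Fin d) (Fin d) ℝ => V.det :=
    (Continuous.matrix_det continuous_id).measurable
  have hadj : Measurable fun V : Matrix (Fin d) (Fin d) ℝ => V.adjugate :=
    (Continuous.matrix_adjugate continuous_id).measurable
  simp only [Matrix.inv_def, Ring.inverse_eq_inv']
  exact hdet.inv.smul hadj

open scoped MatrixOrder in
lemma measurableSet_matrix_nonneg :
    MeasurableSet {a : Matrix (Fin d) (Fin d) ℝ | 0 ≤ a} := by
  have e : {a : Matrix (Fin d) (Fin d) ℝ | 0 ≤ a} = {a | a.conjTranspose = a} ∩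
      ⋂ x : Fin d → ℝ, {a | 0 ≤ star x ⬝ᵥ (a.mulVec x)} := by
    ext a
    simp only [Set.mem_ofPred_eq, Matrix.nonneg_iff_posSemidef, Set.mem_inter_iff, Set.mem_iInter,
      Matrix.posSemidef_iff_dotProduct_mulVec, Matrix.IsHermitian]
  rw [e]
  refine IsClosed.measurableSet (IsClosed.inter ?_ (isClosed_iInter fun x => ?_))
  · exact isClosed_eq (by fun_prop) (by fun_prop)
  · exact isClosed_le (by fun_prop) (by fun_prop)

open scoped Matrix.Norms.L2Operator MatrixOrder in
lemma measurable_matrix_sqrt :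
    Measurable fun V : Matrix (Fin d) (Fin d) ℝ => CFC.sqrt V := by
  have hc : ContinuousOn (CFC.sqrt : Matrix (Fin d) (Fin d) ℝ → _) {a | 0 ≤ a} :=
    CFC.continuousOn_sqrt
  have hs := measurableSet_matrix_nonneg (d := d)
  classical
  have e : (CFC.sqrt : Matrix (Fin d) (Fin d) ℝ → _)
      = Set.piecewise {a | 0 ≤ a} CFC.sqrt (fun _ => 0) := by
    ext1 V
    by_cases h : 0 ≤ V
    · simp [Set.piecewise, h]
    · simp [Set.piecewise, h, CFC.sqrt_of_not_nonneg h]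
  rw [e]
  exact hc.measurable_piecewise continuousOn_const hs

open scoped MatrixOrder in
lemma measurable_multivariateGaussian :
    Measurable fun V : Matrix (Fin d) (Fin d) ℝ => multivariateGaussian (0 : E d) V := by
  have hf : Measurable fun q : Matrix (Fin d) (Fin d) ℝ × E d =>
      (0 : E d) + Matrix.toEuclideanCLM (𝕜 := ℝ) (CFC.sqrt q.1) q.2 := by
    refine measurable_const.add ?_
    have hc : Measurable fun q : Matrix (Fin d) (Fin d) ℝ × E d =>
        WithLp.toLp 2 ((CFC.sqrt q.1).mulVec q.2.ofLp) := by
      have h1 : Measurable fun q : Matrix (Fin d) (Fin d) ℝ × E d => (CFC.sqrt q.1, q.2) :=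
        (measurable_matrix_sqrt.comp measurable_fst).prodMk measurable_snd
      have h2 : Measurable fun q : Matrix (Fin d) (Fin d) ℝ × E d =>
          (WithLp.toLp 2 (q.1.mulVec q.2.ofLp) : E d) := by
        have : Continuous fun q : Matrix (Fin d) (Fin d) ℝ × E d =>
          (WithLp.toLp 2 (q.1.mulVec q.2.ofLp) : E d) := by fun_prop
        exact this.measurable
      exact h2.comp h1
    exact hc
  let κ : Kernel (Matrix (Fin d) (Fin d) ℝ) (E d) :=
    (Kernel.id ×ₖ Kernel.const _ (stdGaussian (E d))).map
      (fun q => (0 : E d) + Matrix.toEuclideanCLM (𝕜 := ℝ) (CFC.sqrt q.1) q.2)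
  have e : (fun V : Matrix (Fin d) (Fin d) ℝ => multivariateGaussian (0 : E d) V) = ⇑κ := by
    ext1 V
    rw [Kernel.map_apply _ hf, Kernel.prod_apply, Kernel.id_apply, Kernel.const_apply,
      Measure.dirac_prod, Measure.map_map hf (by fun_prop)]
    rfl
  rw [e]
  exact Kernel.measurable _

/-- Reward sampling `θ̃ ∼ N(0, V⁻¹)`. -/
def rewardSampling (lam : ℝ) (t : ℕ) : Kernel (Buffer S A t) (E d) where
  toFun b := multivariateGaussian 0 (designMatrix M lam b)⁻¹
  measurable' := measurable_multivariateGaussian.comp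
    (measurable_matrix_inv.comp (measurable_designMatrix M lam))

instance (lam : ℝ) (t : ℕ) : IsMarkovKernel (rewardSampling M lam t) :=
  ⟨fun b => inferInstanceAs
    (IsProbabilityMeasure (multivariateGaussian 0 (designMatrix M lam b)⁻¹))⟩

variable (pol : Kernel (Pol × S) A) [IsMarkovKernel pol]
  (oracle : ℝ → ℝ → Kernel (E d) Pol) [∀ ε δ, IsMarkovKernel (oracle ε δ)]

/-- RL update: given `(π_{t-1}, buffer)`, sample `θ̃_t ∼ N(0, V_t⁻¹)` and call the oracle to
obtain `π_t`. -/
def policyUpdate (lam ε δ' : ℝ) (t : ℕ) : Kernel (Pol × Buffer S A t) Pol :=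
  oracle ε δ' ∘ₖ (rewardSampling M lam t).comap Prod.snd measurable_snd

/-- Given `((π_{t-1}, buffer), π_t)`, sample independently `τ_t ∼ ℙ_{π_t}` and
`τ'_t ∼ ℙ_{π_{t-1}}`. -/
def pairSampling (t : ℕ) :
    Kernel ((Pol × Buffer S A t) × Pol) (Traj S A × Traj S A) :=
  ((trajKernel M pol).comap (fun q => q.2) measurable_snd) ×ₖ
    ((trajKernel M pol).comap (fun q => q.1.1) (by fun_prop))

lemma measurable_snoc {α : Type*} [MeasurableSpace α] (t : ℕ) :
    Measurable fun q : (Fin t → α) × α => (Fin.snoc q.1 q.2 : Fin (t + 1) → α) := by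
  refine measurable_pi_lambda _ fun i => ?_
  refine Fin.lastCases ?_ (fun j => ?_) i
  · simp only [Fin.snoc_last]
    exact measurable_snd
  · simp only [Fin.snoc_castSucc]
    exact (measurable_pi_apply j).comp measurable_fst

/-- The bookkeeping at the end of a round: keep `π_t` and append `(τ_t, τ'_t)` to the buffer. -/
def appendRound {t : ℕ}
    (q : (Pol × Buffer S A t) × (Pol × (Traj S A × Traj S A))) : Pol × Buffer S A (t + 1) :=
  (q.2.1, Fin.snoc q.1.2 q.2.2)

lemma measurable_appendRound {t : ℕ} :
    Measurable (appendRound : (Pol × Buffer S A t) × (Pol × (Traj S A × Traj S A)) → _) :=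
  (by fun_prop : Measurable fun q : (Pol × Buffer S A t) × (Pol × (Traj S A × Traj S A)) =>
    q.2.1).prodMk ((measurable_snoc t).comp
      (by fun_prop : Measurable fun q : (Pol × Buffer S A t) × (Pol × (Traj S A × Traj S A)) =>
        (q.1.2, q.2.2)))

/-- One exploration round, as a kernel from `(π_{t-1}, buffer)` to `(π_t, extended buffer)`. No
preference label is used. -/
def exploreRound (lam ε δ' : ℝ) (t : ℕ) :
    Kernel (Pol × Buffer S A t) (Pol × Buffer S A (t + 1)) :=
  (Kernel.id ×ₖ (policyUpdate M oracle lam ε δ' t ⊗ₖ pairSampling M pol t)).map appendRound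

/-- Law of the last policy and of the buffer after `t` exploration rounds, started at `π₀`. -/
def exploreLaw (lam ε δ' : ℝ) (p₀ : Pol) : (t : ℕ) → Measure (Pol × Buffer S A t)
  | 0 => Measure.dirac (p₀, Fin.elim0)
  | t + 1 => exploreRound M pol oracle lam ε δ' t ∘ₘ exploreLaw lam ε δ' p₀ t

/-- The Bradley-Terry preference law: the label of `(τ, τ')` is `true` (`τ` is preferred) with
probability `σ(⟨θ*, φ(τ) - φ(τ')⟩)`. -/
def preferenceLaw (θs : E d) (z : Traj S A × Traj S A) : Measure Bool :=
  bernoulliMeasure true false (unitInterval.sigmoid (inner ℝ θs (designPoint M z)))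

instance (θs : E d) (z : Traj S A × Traj S A) : IsProbabilityMeasure (preferenceLaw M θs z) := by
  unfold preferenceLaw; infer_instance

/-- The single batch of preference queries: one independent label for each stored pair. -/
def preferenceBatch (θs : E d) (T : ℕ) : Kernel (Buffer S A T) (Fin T → Bool) where
  toFun b := Measure.pi fun i => preferenceLaw M θs (b i)
  measurable' := by
    have h1 : ∀ (i : Fin T) (y : Bool),
        Measurable fun b : Buffer S A T => preferenceLaw M θs (b i) {y} := by
      intro i y
      have hσ : Measurable fun b : Buffer S A T =>
          Real.sigmoid (inner ℝ θs (designPoint M (b i))) :=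
        continuous_sigmoid.measurable.comp (measurable_const.inner
          ((measurable_designPoint M).comp (measurable_pi_apply i)))
      have hI : Measurable fun b : Buffer S A T =>
          unitInterval.sigmoid (inner ℝ θs (designPoint M (b i))) := hσ.subtype_mk
      simp only [preferenceLaw, bernoulliMeasure_def, Measure.add_apply, Measure.smul_apply,
        ENNReal.smul_def, smul_eq_mul]
      refine Measurable.add (Measurable.mul_const ?_ _) (Measurable.mul_const ?_ _)
      · refine measurable_coe_nnreal_ennreal.comp (Measurable.comp (g := unitInterval.toNNReal) ?_ hI)
        exact unitInterval.toNNReal_continuous.measurable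
      · refine measurable_coe_nnreal_ennreal.comp
          (Measurable.comp (g := fun p => unitInterval.toNNReal (unitInterval.symm p)) ?_ hI)
        exact (unitInterval.toNNReal_continuous.comp unitInterval.continuous_symm).measurable
    refine Measure.measurable_of_measurable_coe _ fun s _ => ?_
    have e : ∀ b : Buffer S A T, (Measure.pi fun i => preferenceLaw M θs (b i)) s
        = ∑ y ∈ s.toFinite.toFinset, ∏ i, preferenceLaw M θs (b i) {y i} := by
      intro b
      rw [← Set.Finite.coe_toFinset s.toFinite, ← MeasureTheory.sum_measure_singleton]
      simp
    simp_rw [e]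
    exact Finset.measurable_sum _ fun y _ => Finset.measurable_prod _ fun i _ => h1 i (y i)

instance (θs : E d) (T : ℕ) : IsMarkovKernel (preferenceBatch M θs T) :=
  ⟨fun b => inferInstanceAs (IsProbabilityMeasure (Measure.pi fun i => preferenceLaw M θs (b i)))⟩

/-- The labelled dataset `{(x_i, y_i)}`. -/
def toDataset {T : ℕ} (q : Buffer S A T × (Fin T → Bool)) : Fin T → E d × Bool :=
  fun i => (designPoint M (q.1 i), q.2 i)

lemma measurable_toDataset {T : ℕ} :
    Measurable (toDataset M : Buffer S A T × (Fin T → Bool) → _) := by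
  refine measurable_pi_lambda _ fun i => ?_
  exact ((measurable_designPoint M).comp
    (by fun_prop : Measurable fun q : Buffer S A T × (Fin T → Bool) => q.1 i)).prodMk
    (by fun_prop)

/-- Law of the labelled dataset `𝒟` after exploration and the batch of preference queries. -/
def datasetLaw (θs : E d) (lam ε δ' : ℝ) (p₀ : Pol) (T : ℕ) : Measure (Fin T → E d × Bool) :=
  (((exploreLaw M pol oracle lam ε δ' p₀ T).map Prod.snd) ⊗ₘ preferenceBatch M θs T).map
    (toDataset M)

/-- Law of the output policy `π̂` of RPO-Explore with inputs `T`, `δ`, `λ`, initial policy `π₀`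
and true reward parameter `θ*`: explore for `T` rounds with `ε = 1/√T` and oracle confidence
`δ'/T`, where `δ' = δ/5`; query all labels; compute `θ̂` by the (possibly randomized) selection
`mle`; and return the output of the oracle at `(θ̂, ε, δ')`. -/
def outputLaw (θs : E d) (lam : ℝ) (p₀ : Pol) (T : ℕ) (δ : ℝ)
    (mle : Kernel (Fin T → E d × Bool) (E d)) : Measure Pol :=
  oracle (1 / √T) (δ / 5) ∘ₘ
    (mle ∘ₘ datasetLaw M pol oracle θs lam (1 / √T) (δ / 5 / T) p₀ T)

instance (lam ε δ' : ℝ) (t : ℕ) : IsMarkovKernel (policyUpdate M oracle lam ε δ' t) := by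
  unfold policyUpdate; infer_instance

instance (t : ℕ) : IsMarkovKernel (pairSampling M pol t) := by
  unfold pairSampling; infer_instance

instance (lam ε δ' : ℝ) (t : ℕ) : IsMarkovKernel (exploreRound M pol oracle lam ε δ' t) := by
  unfold exploreRound
  exact Kernel.IsMarkovKernel.map _ measurable_appendRound

instance (lam ε δ' : ℝ) (p₀ : Pol) (t : ℕ) :
    IsProbabilityMeasure (exploreLaw M pol oracle lam ε δ' p₀ t) := by
  induction t with
  | zero => unfold exploreLaw; infer_instance
  | succ t ih => unfold exploreLaw; infer_instance

instance (θs : E d) (lam ε δ' : ℝ) (p₀ : Pol) (T : ℕ) :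
    IsProbabilityMeasure (datasetLaw M pol oracle θs lam ε δ' p₀ T) := by
  unfold datasetLaw
  have := Measure.isProbabilityMeasure_map (μ := exploreLaw M pol oracle lam ε δ' p₀ T)
    measurable_snd.aemeasurable
  exact Measure.isProbabilityMeasure_map (measurable_toDataset M).aemeasurable

instance (θs : E d) (lam : ℝ) (p₀ : Pol) (T : ℕ) (δ : ℝ)
    (mle : Kernel (Fin T → E d × Bool) (E d)) [IsMarkovKernel mle] :
    IsProbabilityMeasure (outputLaw M pol oracle θs lam p₀ T δ mle) := by
  unfold outputLaw; infer_instance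

end Algorithm

end

end RPO

/-! Values are linear in the reward parameter: `V_θ^π = ⟨θ, m(π)⟩`, where `m(π)` is the expected
discounted feature vector. A policy `ε`-optimal for `θ̂` is therefore suboptimal for `θ*` by at most
`ε + ‖θ* - θ̂‖_V · W` (`subOpt_le_of_estimate`). Here `V` is the final design matrix and the width
`W` is the largest `V⁻¹`-norm of a difference `m(π₁) - m(π₂)`. The theorem follows from `W ≲ d/√T`
and `‖θ* - θ̂‖_V ≲ √(κ d)`, up to logarithms and problem factors.

Width. Write the sampled reward as `V^{-1/2} g` with `g` standard Gaussian. The oracle's policy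
nearly beats both `π₁` and `π₂`. The maximum of their two values exceeds the mean of the two by half
the absolute difference; the mean, taken relative to the previous policy, is linear in `g` and
integrates to zero, while the absolute difference integrates to a constant times the `V⁻¹`-norm of
`m(π₁) - m(π₂)`. The gain of the oracle's policy over the previous policy is the mean of an inner
product with the next design point `x`, and Young's inequality bounds it by `α‖g‖²/2 + xᵀV⁻¹x/(2α)`.
Hence a large width forces a large expected `xᵀV⁻¹x` in the next round (`sqrt_qf_le_roundQf`). Each
round multiplies `det V` by `1 + xᵀV⁻¹x` and cannot increase the width, so `exp(t · gainRate(W)) /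
det V` is a supermartingale (`lintegral_potential_exploreRound_le`). Markov's inequality and the
deterministic bound on `det V` then control the final width (`exists_explored_event`).

Estimation. Conditionally on the buffer the labels are independent. The square root of the
likelihood ratio of `θ` against `θ*` has mean at most `exp(-∑ ⟨θ - θ*, xᵢ⟩²/(8κ))`, a Hellinger
affinity bounded through strong convexity of `log(1 + eᵘ)`. Integrating the compensated ratio over
the parameter ball and applying Markov's inequality gives one event on which every maximum
likelihood estimator is controlled, because a shrunken copy of the ball near the estimator already
contributes enough mass (`labelLaw_isMLE_ge`). -/

namespace RPO

noncomputable section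

/-- The squared dual norm `uᵀ V⁻¹ u`. -/
def qf {d : ℕ} (V : Matrix (Fin d) (Fin d) ℝ) (u : E d) : ℝ := u.ofLp ⬝ᵥ (V⁻¹ *ᵥ u.ofLp)

/-! ### Dual norms, determinants and the variational formula for `uᵀ V⁻¹ u`. -/

section LinearAlgebra

variable {d : ℕ} {V : Matrix (Fin d) (Fin d) ℝ}

lemma inner_eq_dotProduct (u v : E d) : inner ℝ u v = u.ofLp ⬝ᵥ v.ofLp := by
  rw [EuclideanSpace.inner_eq_star_dotProduct, dotProduct_comm]; simp

lemma dotProduct_mulVec_comm_of_symm (hV : V.PosSemidef) (x y : Fin d → ℝ) :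
    x ⬝ᵥ (V *ᵥ y) = y ⬝ᵥ (V *ᵥ x) := by
  have h : Vᵀ = V := by simpa using hV.isHermitian.eq
  rw [Matrix.dotProduct_mulVec, ← Matrix.mulVec_transpose, h, dotProduct_comm]

open scoped MatrixOrder in
lemma inner_toEuclideanCLM_sqrt (S : Matrix (Fin d) (Fin d) ℝ) (g u : E d) :
    inner ℝ (Matrix.toEuclideanCLM (𝕜 := ℝ) (CFC.sqrt S) g) u
      = inner ℝ g (Matrix.toEuclideanCLM (𝕜 := ℝ) (CFC.sqrt S) u) := by
  have h : (CFC.sqrt S).PosSemidef := Matrix.nonneg_iff_posSemidef.1 (CFC.sqrt_nonneg S)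
  rw [inner_eq_dotProduct, inner_eq_dotProduct, Matrix.ofLp_toEuclideanCLM,
    Matrix.ofLp_toEuclideanCLM, dotProduct_comm]
  exact dotProduct_mulVec_comm_of_symm h _ _

open scoped MatrixOrder in
lemma norm_sq_toEuclideanCLM_sqrt {S : Matrix (Fin d) (Fin d) ℝ} (hS : S.PosSemidef) (u : E d) :
    ‖Matrix.toEuclideanCLM (𝕜 := ℝ) (CFC.sqrt S) u‖ ^ 2 = u.ofLp ⬝ᵥ (S *ᵥ u.ofLp) := by
  rw [← real_inner_self_eq_norm_sq, inner_toEuclideanCLM_sqrt, inner_eq_dotProduct,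
    Matrix.ofLp_toEuclideanCLM, Matrix.ofLp_toEuclideanCLM, Matrix.mulVec_mulVec,
    CFC.sqrt_mul_sqrt_self S (Matrix.nonneg_iff_posSemidef.2 hS)]

lemma qf_nonneg (hV : V.PosDef) (u : E d) : 0 ≤ qf V u := by
  have := hV.inv.posSemidef.dotProduct_mulVec_nonneg u.ofLp
  simpa [qf] using this

lemma mulVec_inv_mulVec (hV : V.PosDef) (x : Fin d → ℝ) : V *ᵥ (V⁻¹ *ᵥ x) = x := by
  rw [Matrix.mulVec_mulVec, Matrix.mul_nonsing_inv _ ((Matrix.isUnit_iff_isUnit_det _).1 hV.isUnit),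
    Matrix.one_mulVec]

/-- Variational lower bound for the dual norm. -/
lemma two_mul_inner_sub_le_qf (hV : V.PosDef) (Δ u : E d) :
    2 * inner ℝ Δ u - Δ.ofLp ⬝ᵥ (V *ᵥ Δ.ofLp) ≤ qf V u := by
  have h := hV.posSemidef.dotProduct_mulVec_nonneg (Δ.ofLp - V⁻¹ *ᵥ u.ofLp)
  simp only [star_trivial, Matrix.mulVec_sub, sub_dotProduct, dotProduct_sub,
    mulVec_inv_mulVec hV] at h
  have h2 : (V⁻¹ *ᵥ u.ofLp) ⬝ᵥ (V *ᵥ Δ.ofLp) = Δ.ofLp ⬝ᵥ u.ofLp := by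
    rw [dotProduct_mulVec_comm_of_symm hV.posSemidef, mulVec_inv_mulVec hV]
  have h3 : (V⁻¹ *ᵥ u.ofLp) ⬝ᵥ u.ofLp = qf V u := by rw [dotProduct_comm]; rfl
  rw [inner_eq_dotProduct]
  linarith

/-- The supremum in the variational bound is attained at `V⁻¹ u`. Upper bounds on `qf` follow by
estimating this single expression, with no calculus of inverses. -/
lemma qf_eq_variational (hV : V.PosDef) (u : E d) :
    qf V u = 2 * inner ℝ (WithLp.toLp 2 (V⁻¹ *ᵥ u.ofLp) : E d) u
      - (V⁻¹ *ᵥ u.ofLp) ⬝ᵥ (V *ᵥ (V⁻¹ *ᵥ u.ofLp)) := by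
  rw [inner_eq_dotProduct, mulVec_inv_mulVec hV]
  have h3 : (V⁻¹ *ᵥ u.ofLp) ⬝ᵥ u.ofLp = qf V u := by rw [dotProduct_comm]; rfl
  simp only [h3]; ring

lemma qf_anti {V' : Matrix (Fin d) (Fin d) ℝ} (hV : V.PosDef) (hV' : V'.PosDef)
    (h : ∀ x : Fin d → ℝ, x ⬝ᵥ (V *ᵥ x) ≤ x ⬝ᵥ (V' *ᵥ x)) (u : E d) : qf V' u ≤ qf V u := by
  rw [qf_eq_variational hV']
  refine le_trans ?_ (two_mul_inner_sub_le_qf hV (WithLp.toLp 2 (V'⁻¹ *ᵥ u.ofLp)) u)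
  have := h (V'⁻¹ *ᵥ u.ofLp)
  simp only
  linarith

lemma qf_le_norm_sq_div (hV : V.PosDef) {lam : ℝ} (hl : 0 < lam)
    (h : ∀ x : E d, lam * ‖x‖ ^ 2 ≤ x.ofLp ⬝ᵥ (V *ᵥ x.ofLp)) (u : E d) :
    qf V u ≤ ‖u‖ ^ 2 / lam := by
  rw [qf_eq_variational hV]
  set w : E d := WithLp.toLp 2 (V⁻¹ *ᵥ u.ofLp)
  have h1 := h w
  have h2 := real_inner_le_norm w u
  have h3 : 0 ≤ (lam * ‖w‖ - ‖u‖) ^ 2 / lam := by positivity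
  have h4 : (lam * ‖w‖ - ‖u‖) ^ 2 / lam = lam * ‖w‖ ^ 2 - 2 * (‖w‖ * ‖u‖) + ‖u‖ ^ 2 / lam := by
    field_simp
    ring
  change 2 * inner ℝ w u - w.ofLp ⬝ᵥ (V *ᵥ w.ofLp) ≤ _
  linarith

/-- Cauchy–Schwarz for the norm of `V` and its dual. -/
lemma inner_le_sqrt_mul_sqrt (hV : V.PosDef) (Δ u : E d) :
    inner ℝ Δ u ≤ √(Δ.ofLp ⬝ᵥ (V *ᵥ Δ.ofLp)) * √(qf V u) := by
  have hq : 0 ≤ Δ.ofLp ⬝ᵥ (V *ᵥ Δ.ofLp) := by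
    simpa using hV.posSemidef.dotProduct_mulVec_nonneg Δ.ofLp
  rw [← Real.sqrt_mul hq]
  refine Real.le_sqrt_of_sq_le ?_
  -- The variational bound at `s • Δ` is a quadratic in `s` without sign change, so its discriminant
  -- is nonpositive.
  have key : ∀ s : ℝ, 0 ≤ (Δ.ofLp ⬝ᵥ (V *ᵥ Δ.ofLp)) * (s * s) + (-2 * inner ℝ Δ u) * s + qf V u := by
    intro s
    have := two_mul_inner_sub_le_qf hV (s • Δ) u
    simp only [inner_smul_left, WithLp.ofLp_smul, Matrix.mulVec_smul, smul_dotProduct,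
      dotProduct_smul, smul_eq_mul, conj_trivial] at this
    nlinarith
  have := discrim_le_zero key
  rw [discrim] at this
  nlinarith

/-- The matrix determinant lemma: the volume gain of one round is exactly `1 + xᵀ V⁻¹ x`, which lets
`det V` record the information collected. -/
lemma det_add_vecMulVec_self (hV : V.PosDef) (x : E d) :
    (V + Matrix.vecMulVec x.ofLp x.ofLp).det = V.det * (1 + qf V x) := by
  rw [Matrix.vecMulVec_eq Unit, Matrix.det_add_replicateCol_mul_replicateRow
    ((Matrix.isUnit_iff_isUnit_det _).1 hV.isUnit)]
  congr 1
  rw [Matrix.det_unique, Matrix.add_apply, Matrix.one_apply_eq, Matrix.mul_assoc,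
    ← Matrix.replicateCol_mulVec, Matrix.replicateRow_mul_replicateCol_apply]
  rfl

lemma det_le_pow_of_quadratic_le (hV : V.PosDef) {c : ℝ}
    (h : ∀ x : E d, x.ofLp ⬝ᵥ (V *ᵥ x.ofLp) ≤ c * ‖x‖ ^ 2) : V.det ≤ c ^ d := by
  rw [hV.isHermitian.det_eq_prod_eigenvalues]
  have : ∀ i ∈ Finset.univ, hV.isHermitian.eigenvalues i ≤ c := by
    intro i _
    have h1 := h (hV.isHermitian.eigenvectorBasis i)
    have hn : ‖hV.isHermitian.eigenvectorBasis i‖ = 1 := by simp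
    rw [hV.isHermitian.mulVec_eigenvectorBasis, dotProduct_smul, ← inner_eq_dotProduct,
      real_inner_self_eq_norm_sq, hn] at h1
    simpa using h1
  refine (Finset.prod_le_prod (fun i _ => (hV.eigenvalues_pos i).le) this).trans ?_
  simp

lemma dotProduct_vecMulVec_self (x y : Fin d → ℝ) :
    y ⬝ᵥ (Matrix.vecMulVec x x *ᵥ y) = (x ⬝ᵥ y) ^ 2 := by
  rw [Matrix.vecMulVec_mulVec, dotProduct_smul, dotProduct_comm y x]
  simp [sq]

end LinearAlgebra

/-! ### Moments of the standard Gaussian. -/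

section Gaussian

variable {d : ℕ}

/-- The first absolute moment of the standard Gaussian law. -/
def absMoment : ℝ := ∫ x : ℝ, |x| ∂(gaussianReal 0 1)

lemma integrable_abs_gaussianReal : Integrable (fun x : ℝ => |x|) (gaussianReal 0 1) :=
  (IsGaussian.integrable_id (μ := gaussianReal 0 1)).abs

lemma absMoment_pos : 0 < absMoment := by
  refine lt_of_le_of_ne (integral_nonneg fun _ => abs_nonneg _) fun h => ?_
  have h1 := (integral_eq_zero_iff_of_nonneg (fun x => abs_nonneg x)
    integrable_abs_gaussianReal).1 h.symm
  have h2 : gaussianReal 0 1 {x : ℝ | ¬ (|x| = 0)} = 0 := h1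
  have h3 : gaussianReal 0 1 {(0 : ℝ)} = 0 := by
    have := nullSingletonClass_gaussianReal (μ := 0) (v := 1) one_ne_zero
    exact measure_singleton 0
  have h4 : gaussianReal 0 1 (Set.univ : Set ℝ) = 0 := by
    refine measure_mono_null (fun x _ => ?_) (measure_union_null h2 h3)
    by_cases hx : x = 0 <;> simp [hx]
  simp at h4

lemma integrable_inner_stdGaussian (v : E d) :
    Integrable (fun g : E d => inner ℝ g v) (stdGaussian (E d)) :=
  (IsGaussian.integrable_id (μ := stdGaussian (E d))).inner_const v

lemma integral_inner_stdGaussian (v : E d) : ∫ g : E d, inner ℝ g v ∂(stdGaussian (E d)) = 0 := by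
  have := integral_strongDual_stdGaussian (E := E d) (innerSL ℝ v)
  simpa [real_inner_comm] using this

lemma stdGaussian_map_inner (v : E d) :
    (stdGaussian (E d)).map (fun g => inner ℝ g v) = gaussianReal 0 (‖v‖₊ ^ 2) := by
  have h := IsGaussian.map_eq_gaussianReal (μ := stdGaussian (E d)) (innerSL ℝ v)
  rw [integral_strongDual_stdGaussian, variance_dual_stdGaussian, innerSL_apply_norm] at h
  have e : (fun g : E d => inner ℝ g v) = ⇑(innerSL ℝ v) := by
    ext g; simp [real_inner_comm]
  rw [e, h]
  congr 1
  ext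
  simp

lemma integral_abs_inner_stdGaussian (v : E d) :
    ∫ g : E d, |inner ℝ g v| ∂(stdGaussian (E d)) = absMoment * ‖v‖ := by
  have h : ∫ g : E d, |inner ℝ g v| ∂(stdGaussian (E d))
      = ∫ x, |x| ∂((stdGaussian (E d)).map (fun g => inner ℝ g v)) := by
    rw [integral_map (by fun_prop) (by fun_prop)]
  rw [h, stdGaussian_map_inner]
  have h2 : gaussianReal 0 (‖v‖₊ ^ 2) = (gaussianReal 0 1).map (fun x => ‖v‖ * x) := by
    rw [gaussianReal_map_const_mul]
    congr 1
    · simp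
    · ext; simp
  rw [h2, integral_map (by fun_prop) (by fun_prop)]
  simp_rw [abs_mul, abs_norm, integral_const_mul]
  rw [absMoment, mul_comm]

lemma integral_inner_sq_stdGaussian (v : E d) :
    ∫ g : E d, (inner ℝ g v) ^ 2 ∂(stdGaussian (E d)) = ‖v‖ ^ 2 := by
  have h : ∫ g : E d, (inner ℝ g v) ^ 2 ∂(stdGaussian (E d))
      = ∫ x, x ^ 2 ∂((stdGaussian (E d)).map (fun g => inner ℝ g v)) := by
    rw [integral_map (by fun_prop) (by fun_prop)]
  have hv := variance_fun_id_gaussianReal (μ := 0) (v := ‖v‖₊ ^ 2)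
  rw [variance_eq_integral (by fun_prop)] at hv
  rw [h, stdGaussian_map_inner]
  simpa using hv

lemma integrable_norm_sq_stdGaussian :
    Integrable (fun g : E d => ‖g‖ ^ 2) (stdGaussian (E d)) :=
  (IsGaussian.memLp_two_id (μ := stdGaussian (E d))).integrable_norm_pow (by norm_num)

lemma integral_norm_sq_stdGaussian :
    ∫ g : E d, ‖g‖ ^ 2 ∂(stdGaussian (E d)) = d := by
  have h : ∀ g : E d, ‖g‖ ^ 2 = ∑ i, (inner ℝ g (EuclideanSpace.single i (1 : ℝ) : E d)) ^ 2 := by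
    intro g
    rw [EuclideanSpace.norm_sq_eq]
    simp [EuclideanSpace.inner_single_right]
  simp_rw [h]
  rw [integral_finsetSum]
  · simp_rw [integral_inner_sq_stdGaussian]
    simp
  · intro i _
    refine Integrable.mono' integrable_norm_sq_stdGaussian (by fun_prop) (ae_of_all _ fun g => ?_)
    have := abs_real_inner_le_norm g (EuclideanSpace.single i (1 : ℝ) : E d)
    simp only [PiLp.norm_single, norm_one, mul_one] at this
    rw [Real.norm_eq_abs, abs_pow]
    gcongr

lemma integrable_norm_stdGaussian : Integrable (fun g : E d => ‖g‖) (stdGaussian (E d)) :=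
  (IsGaussian.integrable_id (μ := stdGaussian (E d))).norm

/-- Integrate the pointwise inequality `‖g‖ ≤ ‖g‖²/(2√d) + √d/2` and use that the second moment is
`d`. -/
lemma integral_norm_stdGaussian_le (hd : 1 ≤ d) :
    ∫ g : E d, ‖g‖ ∂(stdGaussian (E d)) ≤ √d := by
  have hs : (0 : ℝ) < √d := Real.sqrt_pos.2 (by exact_mod_cast hd)
  have hsq : √(d : ℝ) ^ 2 = d := Real.sq_sqrt (by positivity)
  have h : ∀ g : E d, ‖g‖ ≤ ‖g‖ ^ 2 / (2 * √d) + √d / 2 := by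
    intro g
    have : 0 ≤ (‖g‖ - √d) ^ 2 / (2 * √d) := by positivity
    have e : (‖g‖ - √d) ^ 2 / (2 * √d) = ‖g‖ ^ 2 / (2 * √d) + √d / 2 - ‖g‖ := by
      field_simp
      ring
    linarith
  have hi : Integrable (fun g : E d => ‖g‖ ^ 2 / (2 * √d) + √d / 2) (stdGaussian (E d)) :=
    (integrable_norm_sq_stdGaussian.div_const _).add (integrable_const _)
  refine (integral_mono integrable_norm_stdGaussian hi h).trans ?_
  rw [integral_add (integrable_norm_sq_stdGaussian.div_const _) (integrable_const _),
    integral_div, integral_norm_sq_stdGaussian]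
  simp only [integral_const, probReal_univ, smul_eq_mul, one_mul]
  rw [← hsq]
  apply le_of_eq
  field_simp
  rw [Real.sqrt_sq hs.le]
  ring

end Gaussian

/-! ### Values as linear functions of the expected feature vector. -/

section Values

variable {S A : Type*} [MeasurableSpace S] [MeasurableSpace A] {d : ℕ}

namespace FeatureMDP

variable (M : FeatureMDP S A d)

/-- The expected discounted feature vector of a policy. -/
def meanFeature (π : Policy S A) : E d := ∫ τ, M.trajFeature τ ∂(M.trajLaw π)

lemma horizon_pos : 0 < M.horizon := inv_pos.2 (by linarith [M.γ_lt_one])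

variable {L : ℝ}

lemma summable_trajFeature (hL : ∀ s a, ‖M.φ (s, a)‖ ≤ L) (τ : Traj S A) :
    Summable fun h : ℕ => M.γ ^ h • M.φ (τ h) := by
  refine Summable.of_norm_bounded (g := fun h => M.γ ^ h * L)
    ((summable_geometric_of_lt_one M.γ_pos.le M.γ_lt_one).mul_right L) fun h => ?_
  rw [norm_smul, Real.norm_of_nonneg (pow_nonneg M.γ_pos.le h)]
  exact mul_le_mul_of_nonneg_left (hL _ _) (pow_nonneg M.γ_pos.le h)

lemma norm_trajFeature_le (hL : ∀ s a, ‖M.φ (s, a)‖ ≤ L) (τ : Traj S A) :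
    ‖M.trajFeature τ‖ ≤ L * M.horizon := by
  have hg : HasSum (fun h : ℕ => M.γ ^ h * L) (M.horizon * L) :=
    (hasSum_geometric_of_lt_one M.γ_pos.le M.γ_lt_one).mul_right L
  rw [mul_comm]
  refine tsum_of_norm_bounded hg fun h => ?_
  rw [norm_smul, Real.norm_of_nonneg (pow_nonneg M.γ_pos.le h)]
  exact mul_le_mul_of_nonneg_left (hL _ _) (pow_nonneg M.γ_pos.le h)

lemma integrable_trajFeature (hL : ∀ s a, ‖M.φ (s, a)‖ ≤ L) (μ : Measure (Traj S A))
    [IsFiniteMeasure μ] : Integrable M.trajFeature μ :=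
  Integrable.of_bound M.measurable_trajFeature.aestronglyMeasurable (L * M.horizon)
    (ae_of_all _ (M.norm_trajFeature_le hL))

lemma norm_meanFeature_le (hL : ∀ s a, ‖M.φ (s, a)‖ ≤ L) (π : Policy S A) :
    ‖M.meanFeature π‖ ≤ L * M.horizon := by
  have := norm_integral_le_of_norm_le_const (μ := M.trajLaw π)
    (ae_of_all _ (M.norm_trajFeature_le hL))
  simpa [meanFeature] using this

lemma value_eq_inner (hL : ∀ s a, ‖M.φ (s, a)‖ ≤ L) (θ : E d) (π : Policy S A) :
    M.value θ π = inner ℝ θ (M.meanFeature π) := by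
  rw [meanFeature, ← integral_inner (M.integrable_trajFeature hL _)]
  refine integral_congr_ae (ae_of_all _ fun τ => ?_)
  have h := (innerSL ℝ θ).map_tsum (M.summable_trajFeature hL τ)
  simp only [innerSL_apply_apply, inner_smul_right] at h
  exact h.symm

lemma norm_meanFeature_sub_le (hL : ∀ s a, ‖M.φ (s, a)‖ ≤ L) (π π' : Policy S A) :
    ‖M.meanFeature π - M.meanFeature π'‖ ≤ 2 * L * M.horizon := by
  have h1 := norm_sub_le (M.meanFeature π) (M.meanFeature π')
  have h2 := M.norm_meanFeature_le hL π
  have h3 := M.norm_meanFeature_le hL π'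
  linarith

lemma norm_designPoint_le (hL : ∀ s a, ‖M.φ (s, a)‖ ≤ L) (z : Traj S A × Traj S A) :
    ‖designPoint M z‖ ≤ 2 * L * M.horizon := by
  have h1 := norm_sub_le (M.trajFeature z.1) (M.trajFeature z.2)
  have h2 := M.norm_trajFeature_le hL z.1
  have h3 := M.norm_trajFeature_le hL z.2
  rw [designPoint]
  linarith

lemma bddAbove_value (hL : ∀ s a, ‖M.φ (s, a)‖ ≤ L) (θ : E d) :
    BddAbove (Set.range fun π : Policy S A => M.value θ π) := by
  refine ⟨‖θ‖ * (L * M.horizon), ?_⟩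
  rintro _ ⟨π, rfl⟩
  simp only [M.value_eq_inner hL]
  exact (real_inner_le_norm _ _).trans
    (mul_le_mul_of_nonneg_left (M.norm_meanFeature_le hL π) (norm_nonneg _))

lemma inner_sub_le_subOpt (hL : ∀ s a, ‖M.φ (s, a)‖ ≤ L) (θ : E d) (π π' : Policy S A) :
    inner ℝ θ (M.meanFeature π' - M.meanFeature π) ≤ M.subOpt θ π := by
  have h := le_ciSup (M.bddAbove_value hL θ) π'
  rw [inner_sub_right, subOpt, optValue, ← M.value_eq_inner hL, ← M.value_eq_inner hL]
  linarith

lemma subOpt_le_of_forall (hL : ∀ s a, ‖M.φ (s, a)‖ ≤ L) (θ : E d) (π : Policy S A) {c : ℝ}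
    (h : ∀ π', inner ℝ θ (M.meanFeature π' - M.meanFeature π) ≤ c) : M.subOpt θ π ≤ c := by
  have : Nonempty (Policy S A) := ⟨π⟩
  rw [subOpt, optValue, sub_le_iff_le_add]
  refine ciSup_le fun π' => ?_
  have := h π'
  rw [inner_sub_right, ← M.value_eq_inner hL, ← M.value_eq_inner hL] at this
  linarith

lemma subOpt_nonneg (hL : ∀ s a, ‖M.φ (s, a)‖ ≤ L) (θ : E d) (π : Policy S A) :
    0 ≤ M.subOpt θ π := by
  simpa using M.inner_sub_le_subOpt hL θ π π

lemma nonneg_of_norm_le (hL : ∀ s a, ‖M.φ (s, a)‖ ≤ L) (π : Policy S A) : 0 ≤ L := by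
  have := (norm_nonneg _).trans (M.norm_meanFeature_le hL π)
  exact nonneg_of_mul_nonneg_left this M.horizon_pos

end FeatureMDP

variable {Pol : Type*} [MeasurableSpace Pol] (M : FeatureMDP S A d)
  (pol : Kernel (Pol × S) A) [IsMarkovKernel pol]

lemma measurable_value (θ : E d) : Measurable fun p => M.value θ (polAt pol p) := by
  have hm : Measurable fun τ : Traj S A => ∑' h : ℕ, M.γ ^ h * inner ℝ θ (M.φ (τ h)) := by
    refine Measurable.tsum fun h => ?_
    have hm : Measurable fun τ : Traj S A => M.φ (τ h) :=
      M.measurable_φ.comp (measurable_pi_apply h)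
    exact (measurable_const.inner hm).const_mul _
  exact (hm.stronglyMeasurable.integral_kernel (κ := trajKernel M pol)).measurable

lemma measurable_subOpt (θ : E d) : Measurable fun p => M.subOpt θ (polAt pol p) :=
  measurable_const.sub (measurable_value M pol θ)

end Values

/-! ### The design matrix and its determinant. -/

section DesignMatrix

variable {S A : Type*} [MeasurableSpace S] [MeasurableSpace A] {d : ℕ} (M : FeatureMDP S A d)
  {lam : ℝ} {t : ℕ}

lemma quadratic_designMatrix (lam : ℝ) (b : Buffer S A t) (x : E d) :
    x.ofLp ⬝ᵥ (designMatrix M lam b *ᵥ x.ofLp)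
      = lam * ‖x‖ ^ 2 + ∑ k, (inner ℝ (designPoint M (b k)) x) ^ 2 := by
  rw [designMatrix, Matrix.add_mulVec, Matrix.sum_mulVec, dotProduct_add, dotProduct_sum,
    Matrix.smul_mulVec, Matrix.one_mulVec, dotProduct_smul, ← inner_eq_dotProduct,
    real_inner_self_eq_norm_sq, smul_eq_mul]
  simp_rw [dotProduct_vecMulVec_self, inner_eq_dotProduct]

lemma posDef_designMatrix (hl : 0 < lam) (b : Buffer S A t) : (designMatrix M lam b).PosDef := by
  refine Matrix.PosDef.add_posSemidef (Matrix.PosDef.one.smul hl)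
    (Matrix.posSemidef_sum _ fun k _ => ?_)
  simpa using Matrix.posSemidef_vecMulVec_self_star (designPoint M (b k)).ofLp

lemma lam_mul_norm_sq_le (lam : ℝ) (b : Buffer S A t) (x : E d) :
    lam * ‖x‖ ^ 2 ≤ x.ofLp ⬝ᵥ (designMatrix M lam b *ᵥ x.ofLp) := by
  rw [quadratic_designMatrix]
  have : 0 ≤ ∑ k, (inner ℝ (designPoint M (b k)) x) ^ 2 := Finset.sum_nonneg fun _ _ => sq_nonneg _
  linarith

lemma designMatrix_snoc (lam : ℝ) (b : Buffer S A t) (z : Traj S A × Traj S A) :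
    designMatrix M lam (Fin.snoc b z : Buffer S A (t + 1))
      = designMatrix M lam b
        + Matrix.vecMulVec (designPoint M z).ofLp (designPoint M z).ofLp := by
  rw [designMatrix, designMatrix, Fin.sum_univ_castSucc, add_assoc]
  simp

lemma det_designMatrix_snoc (hl : 0 < lam) (b : Buffer S A t) (z : Traj S A × Traj S A) :
    (designMatrix M lam (Fin.snoc b z : Buffer S A (t + 1))).det
      = (designMatrix M lam b).det * (1 + qf (designMatrix M lam b) (designPoint M z)) := by
  rw [designMatrix_snoc, det_add_vecMulVec_self (posDef_designMatrix M hl b)]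

lemma qf_designMatrix_snoc_le (hl : 0 < lam) (b : Buffer S A t) (z : Traj S A × Traj S A)
    (u : E d) : qf (designMatrix M lam (Fin.snoc b z : Buffer S A (t + 1))) u
      ≤ qf (designMatrix M lam b) u := by
  refine qf_anti (posDef_designMatrix M hl _) (posDef_designMatrix M hl _) (fun x => ?_) u
  rw [designMatrix_snoc, Matrix.add_mulVec, dotProduct_add, dotProduct_vecMulVec_self]
  nlinarith [sq_nonneg ((designPoint M z).ofLp ⬝ᵥ x)]

lemma qf_designMatrix_le (hl : 0 < lam) (b : Buffer S A t) {u : E d} {r : ℝ} (hu : ‖u‖ ≤ r) :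
    qf (designMatrix M lam b) u ≤ (r / √lam) ^ 2 := by
  refine (qf_le_norm_sq_div (posDef_designMatrix M hl b) hl (lam_mul_norm_sq_le M lam b) u).trans ?_
  rw [div_pow, Real.sq_sqrt hl.le]
  gcongr

lemma det_designMatrix_le (hl : 0 < lam) {L : ℝ} (hL : ∀ s a, ‖M.φ (s, a)‖ ≤ L)
    (b : Buffer S A t) :
    (designMatrix M lam b).det ≤ (lam * (1 + t * (2 * L * M.horizon / √lam) ^ 2)) ^ d := by
  refine det_le_pow_of_quadratic_le (posDef_designMatrix M hl b) fun x => ?_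
  rw [quadratic_designMatrix]
  have h : ∑ k, (inner ℝ (designPoint M (b k)) x) ^ 2
      ≤ ∑ _k : Fin t, (2 * L * M.horizon) ^ 2 * ‖x‖ ^ 2 := by
    refine Finset.sum_le_sum fun k _ => ?_
    rw [← mul_pow, ← sq_abs]
    refine pow_le_pow_left₀ (abs_nonneg _) ((abs_real_inner_le_norm _ _).trans ?_) 2
    gcongr
    exact M.norm_designPoint_le hL _
  simp only [Finset.sum_const, Finset.card_univ, Fintype.card_fin, nsmul_eq_mul] at h
  rw [div_pow, Real.sq_sqrt hl.le]
  refine (add_le_add_right h _).trans (le_of_eq ?_)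
  field_simp

lemma measurable_qf_designMatrix (lam : ℝ) (u : E d) :
    Measurable fun b : Buffer S A t => qf (designMatrix M lam b) u := by
  have hc : Continuous fun V : Matrix (Fin d) (Fin d) ℝ => u.ofLp ⬝ᵥ (V *ᵥ u.ofLp) := by fun_prop
  exact hc.measurable.comp (measurable_matrix_inv.comp (measurable_designMatrix M lam))

lemma measurable_qf_designPoint (V : Matrix (Fin d) (Fin d) ℝ) :
    Measurable fun z => qf V (designPoint M z) := by
  have hc : Continuous fun u : E d => qf V u := by unfold qf; fun_prop
  exact hc.measurable.comp (measurable_designPoint M)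

lemma measurable_det_designMatrix (lam : ℝ) :
    Measurable fun b : Buffer S A t => (designMatrix M lam b).det := by
  have hc : Continuous fun V : Matrix (Fin d) (Fin d) ℝ => V.det :=
    Continuous.matrix_det continuous_id
  exact hc.measurable.comp (measurable_designMatrix M lam)

end DesignMatrix

/-- The oracle guarantee is used during exploration only in expectation: a failure costs at most its
probability times the bound `D`, so no union bound over rounds is needed. -/
lemma integral_le_of_prob_ge {Ω : Type*} [MeasurableSpace Ω] {μ : Measure Ω}
    [IsProbabilityMeasure μ] {f : Ω → ℝ} (hf : Measurable f) {D ε δ : ℝ} (hε : 0 ≤ ε)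
    (h0 : ∀ x, 0 ≤ f x) (hD : ∀ x, f x ≤ D) (h : ENNReal.ofReal (1 - δ) ≤ μ {x | f x ≤ ε}) :
    ∫ x, f x ∂μ ≤ ε + δ * D := by
  have hD0 : 0 ≤ D := by
    obtain ⟨x⟩ : Nonempty Ω := nonempty_of_isProbabilityMeasure μ
    exact (h0 x).trans (hD x)
  have hs : MeasurableSet {x | f x ≤ ε} := hf measurableSet_Iic
  have hp : 1 - δ ≤ μ.real {x | f x ≤ ε} := by
    rw [measureReal_def]
    exact (ENNReal.ofReal_le_iff_le_toReal (measure_ne_top _ _)).1 h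
  have hc : μ.real {x | f x ≤ ε}ᶜ ≤ δ := by
    rw [probReal_compl_eq_one_sub hs]; linarith
  have hle : ∀ x, f x ≤ ε + Set.indicator {x | f x ≤ ε}ᶜ (fun _ => D) x := by
    intro x
    by_cases hx : f x ≤ ε
    · simp [hx]
    · have : x ∈ {x | f x ≤ ε}ᶜ := hx
      rw [Set.indicator_of_mem this]
      linarith [hD x]
  have hi : Integrable (Set.indicator {x | f x ≤ ε}ᶜ (fun _ => D)) μ :=
    (integrable_const D).indicator hs.compl
  have hif : Integrable f μ := Integrable.of_bound hf.aestronglyMeasurable D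
    (ae_of_all _ fun x => by rw [Real.norm_of_nonneg (h0 x)]; exact hD x)
  refine (integral_mono hif ((integrable_const ε).add hi) hle).trans ?_
  simp only [Pi.add_apply]
  rw [integral_add (integrable_const ε) hi, integral_indicator hs.compl, setIntegral_const]
  simp only [integral_const, probReal_univ, smul_eq_mul, one_mul]
  gcongr

/-! ### Information gain of one exploration round. -/

section OneStep

variable {S A Pol : Type*} [MeasurableSpace S] [MeasurableSpace A] [MeasurableSpace Pol] {d : ℕ}
  (M : FeatureMDP S A d) {lam : ℝ} {t : ℕ} {L : ℝ}
  (pol : Kernel (Pol × S) A) [IsMarkovKernel pol]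
  (oracle : ℝ → ℝ → Kernel (E d) Pol) [∀ ε δ, IsMarkovKernel (oracle ε δ)]

/-- The expected squared dual norm of the design point when the two trajectories are sampled from
the policies `p'` and `p`. -/
def meanQf (V : Matrix (Fin d) (Fin d) ℝ) (p p' : Pol) : ℝ :=
  ∫ z, qf V (designPoint M z) ∂((trajKernel M pol p').prod (trajKernel M pol p))

/-- The expected squared dual norm of the next design point. -/
def roundQf (lam ε δ' : ℝ) (p : Pol) (b : Buffer S A t) : ℝ :=
  ∫ q, qf (designMatrix M lam b) (designPoint M q.2)
    ∂((policyUpdate M oracle lam ε δ' t ⊗ₖ pairSampling M pol t) (p, b))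

lemma trajKernel_apply (p : Pol) : trajKernel M pol p = M.trajLaw (polAt pol p) := rfl

lemma integral_inner_designPoint (hL : ∀ s a, ‖M.φ (s, a)‖ ≤ L) (θ : E d) (p p' : Pol) :
    ∫ z, inner ℝ θ (designPoint M z) ∂((trajKernel M pol p').prod (trajKernel M pol p))
      = inner ℝ θ (M.meanFeature (polAt pol p') - M.meanFeature (polAt pol p)) := by
  have h1 := (M.integrable_trajFeature hL (trajKernel M pol p')).comp_fst (trajKernel M pol p)
  have h2 := (M.integrable_trajFeature hL (trajKernel M pol p)).comp_snd (trajKernel M pol p')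
  have hi : Integrable (designPoint M) ((trajKernel M pol p').prod (trajKernel M pol p)) :=
    h1.sub h2
  rw [integral_inner hi]
  congr 1
  simp only [designPoint]
  rw [integral_sub h1 h2, integral_fun_fst, integral_fun_snd]
  simp [trajKernel_apply, FeatureMDP.meanFeature]

lemma abs_qf_designPoint_le (hl : 0 < lam) (hL : ∀ s a, ‖M.φ (s, a)‖ ≤ L) (b : Buffer S A t)
    (z : Traj S A × Traj S A) :
    ‖qf (designMatrix M lam b) (designPoint M z)‖ ≤ (2 * L * M.horizon / √lam) ^ 2 := by
  rw [Real.norm_of_nonneg (qf_nonneg (posDef_designMatrix M hl b) _)]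
  exact qf_designMatrix_le M hl b (M.norm_designPoint_le hL z)

lemma measurable_meanQf (V : Matrix (Fin d) (Fin d) ℝ) (p : Pol) :
    Measurable (meanQf M pol V p) := by
  have := ((measurable_qf_designPoint M V).stronglyMeasurable.integral_kernel
    (κ := trajKernel M pol ×ₖ Kernel.const Pol (trajKernel M pol p))).measurable
  simp only [Kernel.prod_apply, Kernel.const_apply] at this
  exact this

lemma norm_meanQf_le (hl : 0 < lam) (hL : ∀ s a, ‖M.φ (s, a)‖ ≤ L) (b : Buffer S A t)
    (p p' : Pol) :
    ‖meanQf M pol (designMatrix M lam b) p p'‖ ≤ (2 * L * M.horizon / √lam) ^ 2 := by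
  have := norm_integral_le_of_norm_le_const
    (μ := (trajKernel M pol p').prod (trajKernel M pol p))
    (ae_of_all _ (abs_qf_designPoint_le M hl hL b))
  simpa [meanQf] using this

-- The policy `p'` depends on `g` through the oracle, so the inner product cannot be averaged over
-- `g` first. Cauchy–Schwarz and Young's inequality, applied to each pair of trajectories before
-- averaging, separate `‖g‖²` from the information gain.
open scoped MatrixOrder in
lemma inner_meanFeature_sub_le (hl : 0 < lam) (hL : ∀ s a, ‖M.φ (s, a)‖ ≤ L) (b : Buffer S A t)
    {α : ℝ} (hα : 0 < α) (g : E d) (p p' : Pol) :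
    inner ℝ (Matrix.toEuclideanCLM (𝕜 := ℝ) (CFC.sqrt (designMatrix M lam b)⁻¹) g)
      (M.meanFeature (polAt pol p') - M.meanFeature (polAt pol p))
      ≤ α / 2 * ‖g‖ ^ 2 + meanQf M pol (designMatrix M lam b) p p' / (2 * α) := by
  set V := designMatrix M lam b
  have hV : V.PosDef := posDef_designMatrix M hl b
  have hq : Integrable (fun z => qf V (designPoint M z))
      ((trajKernel M pol p').prod (trajKernel M pol p)) :=
    Integrable.of_bound (measurable_qf_designPoint M V).aestronglyMeasurable _
      (ae_of_all _ (abs_qf_designPoint_le M hl hL b))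
  have hx : Integrable (designPoint M) ((trajKernel M pol p').prod (trajKernel M pol p)) :=
    Integrable.of_bound (measurable_designPoint M).aestronglyMeasurable _
      (ae_of_all _ (M.norm_designPoint_le hL))
  rw [← integral_inner_designPoint M pol hL]
  refine (integral_mono (hx.const_inner _)
    ((integrable_const (α / 2 * ‖g‖ ^ 2)).add (hq.div_const (2 * α))) fun z => ?_).trans ?_
  · rw [inner_toEuclideanCLM_sqrt]
    refine (real_inner_le_norm _ _).trans ?_
    have h := norm_sq_toEuclideanCLM_sqrt hV.inv.posSemidef (designPoint M z)
    set n := ‖Matrix.toEuclideanCLM (𝕜 := ℝ) (CFC.sqrt V⁻¹) (designPoint M z)‖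
    change n ^ 2 = qf V (designPoint M z) at h
    simp only [Pi.add_apply]
    rw [← h]
    have h2 : 0 ≤ (α * ‖g‖ - n) ^ 2 / (2 * α) := by positivity
    have h3 : (α * ‖g‖ - n) ^ 2 / (2 * α) = α / 2 * ‖g‖ ^ 2 + n ^ 2 / (2 * α) - ‖g‖ * n := by
      field_simp
      ring
    linarith
  · simp only [Pi.add_apply]
    rw [integral_add (integrable_const _) (hq.div_const _), integral_div]
    simp [meanQf]

open scoped MatrixOrder in
lemma subOpt_toEuclideanCLM_sqrt_le (hl : 0 < lam) (hL : ∀ s a, ‖M.φ (s, a)‖ ≤ L)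
    (b : Buffer S A t) (g : E d) (π : Policy S A) :
    M.subOpt (Matrix.toEuclideanCLM (𝕜 := ℝ) (CFC.sqrt (designMatrix M lam b)⁻¹) g) π
      ≤ ‖g‖ * (2 * L * M.horizon / √lam) := by
  have hL0 := M.nonneg_of_norm_le hL π
  have hH := M.horizon_pos
  refine M.subOpt_le_of_forall hL _ _ fun π' => ?_
  rw [inner_toEuclideanCLM_sqrt]
  refine (real_inner_le_norm _ _).trans (mul_le_mul_of_nonneg_left ?_ (norm_nonneg _))
  refine le_of_sq_le_sq ?_ (by positivity)
  rw [norm_sq_toEuclideanCLM_sqrt (posDef_designMatrix M hl b).inv.posSemidef]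
  exact qf_designMatrix_le M hl b (M.norm_meanFeature_sub_le hL _ _)

-- Unfolds the composed kernels and writes the sampled reward as `V^{-1/2} g`, so that later steps
-- are integrals over a standard Gaussian.
open scoped MatrixOrder in
lemma roundQf_eq (hl : 0 < lam) (hL : ∀ s a, ‖M.φ (s, a)‖ ≤ L) (ε δ' : ℝ) (p : Pol)
    (b : Buffer S A t) :
    roundQf M pol oracle lam ε δ' p b = ∫ g, ∫ p', meanQf M pol (designMatrix M lam b) p p'
      ∂(oracle ε δ' (Matrix.toEuclideanCLM (𝕜 := ℝ) (CFC.sqrt (designMatrix M lam b)⁻¹) g))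
      ∂(stdGaussian (E d)) := by
  rw [roundQf]
  set V := designMatrix M lam b
  rw [_root_.ProbabilityTheory.integral_compProd]
  swap
  · exact Integrable.of_bound
      ((measurable_qf_designPoint M V).comp measurable_snd).aestronglyMeasurable _
      (ae_of_all _ fun q => abs_qf_designPoint_le M hl hL b q.2)
  have h1 : ∀ p', ∫ z, qf V (designPoint M (p', z).2) ∂(pairSampling M pol t ((p, b), p'))
      = meanQf M pol V p p' := by
    intro p'
    rw [pairSampling, Kernel.prod_apply, Kernel.comap_apply, Kernel.comap_apply, meanQf]
  simp_rw [h1]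
  rw [policyUpdate, Kernel.integral_comp]
  swap
  · exact Integrable.of_bound (measurable_meanQf M pol V p).aestronglyMeasurable _
      (ae_of_all _ fun q => norm_meanQf_le M pol hl hL b p q)
  rw [Kernel.comap_apply]
  change ∫ θ, _ ∂(multivariateGaussian 0 V⁻¹) = _
  rw [multivariateGaussian, integral_map (by fun_prop)]
  · simp only [zero_add]
  · exact (measurable_meanQf M pol V p).stronglyMeasurable.integral_kernel.aestronglyMeasurable

open scoped MatrixOrder in
/-- The width in any feature direction is controlled by the expected information gain of one
exploration round. -/
lemma sqrt_qf_le_roundQf (hd : 1 ≤ d) (hl : 0 < lam) (hL : ∀ s a, ‖M.φ (s, a)‖ ≤ L)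
    (hO : IsPACOracle M pol oracle) {ε δ' α : ℝ} (hε : 0 < ε) (hδ : 0 < δ') (hδ1 : δ' < 1)
    (hα : 0 < α) (p : Pol) (b : Buffer S A t) (π₁ π₂ : Policy S A) :
    absMoment / 2 * √(qf (designMatrix M lam b) (M.meanFeature π₁ - M.meanFeature π₂))
      ≤ ε + √d * (2 * L * M.horizon / √lam) * δ' + α * d / 2
        + roundQf M pol oracle lam ε δ' p b / (2 * α) := by
  have hL0 := M.nonneg_of_norm_le hL π₁
  have hH := M.horizon_pos
  rw [roundQf_eq M pol oracle hl hL]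
  set V := designMatrix M lam b
  have hV : V.PosDef := posDef_designMatrix M hl b
  set Q : E d →L[ℝ] E d := Matrix.toEuclideanCLM (𝕜 := ℝ) (CFC.sqrt V⁻¹) with hQ
  set R := 2 * L * M.horizon / √lam
  have hR : 0 ≤ R := by positivity
  set u := M.meanFeature π₁ - M.meanFeature π₂
  -- The midpoint of the two comparators, relative to the previous policy; it does not depend on
  -- `g`, so its contribution has mean zero.
  set w := (1 / 2 : ℝ) • (M.meanFeature π₁ + M.meanFeature π₂) - M.meanFeature (polAt pol p)
  set G : E d → ℝ := fun g => ∫ p', meanQf M pol V p p' ∂(oracle ε δ' (Q g)) with hG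
  have hGm : Measurable G :=
    (measurable_meanQf M pol V p).stronglyMeasurable.integral_kernel.measurable.comp
      Q.continuous.measurable
  have hGi : Integrable G (stdGaussian (E d)) := by
    refine Integrable.of_bound hGm.aestronglyMeasurable (R ^ 2) (ae_of_all _ fun g => ?_)
    have := norm_integral_le_of_norm_le_const (μ := oracle ε δ' (Q g))
      (ae_of_all _ (norm_meanQf_le M pol hl hL b p))
    simpa using this
  -- For fixed `g`, insert the oracle's policy `p'` between `π` and `p`: the first difference is at
  -- most the suboptimality of `p'`, the second is covered by the Young bound. Then average over
  -- `p'`.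
  have hstep : ∀ g : E d, ∀ π : Policy S A,
      inner ℝ (Q g) (M.meanFeature π - M.meanFeature (polAt pol p))
        ≤ ε + δ' * (‖g‖ * R) + α / 2 * ‖g‖ ^ 2 + G g / (2 * α) := by
    intro g π
    have hs := measurable_subOpt M pol (Q g)
    have h1 : ∫ p', M.subOpt (Q g) (polAt pol p') ∂(oracle ε δ' (Q g)) ≤ ε + δ' * (‖g‖ * R) :=
      integral_le_of_prob_ge hs hε.le (fun p' => M.subOpt_nonneg hL _ _)
        (fun p' => subOpt_toEuclideanCLM_sqrt_le M hl hL b g _) (hO ε hε δ' hδ hδ1 (Q g))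
    have hsi : Integrable (fun p' => M.subOpt (Q g) (polAt pol p')) (oracle ε δ' (Q g)) :=
      Integrable.of_bound hs.aestronglyMeasurable (‖g‖ * R) (ae_of_all _ fun p' => by
        rw [Real.norm_of_nonneg (M.subOpt_nonneg hL _ _)]
        exact subOpt_toEuclideanCLM_sqrt_le M hl hL b g _)
    have hmi : Integrable (fun p' => meanQf M pol V p p' / (2 * α)) (oracle ε δ' (Q g)) :=
      (Integrable.of_bound (measurable_meanQf M pol V p).aestronglyMeasurable _
        (ae_of_all _ (norm_meanQf_le M pol hl hL b p))).div_const _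
    have hpt : ∀ p', inner ℝ (Q g) (M.meanFeature π - M.meanFeature (polAt pol p))
        ≤ M.subOpt (Q g) (polAt pol p') + (α / 2 * ‖g‖ ^ 2 + meanQf M pol V p p' / (2 * α)) := by
      intro p'
      have e1 := M.inner_sub_le_subOpt hL (Q g) (polAt pol p') π
      have e2 := inner_meanFeature_sub_le M pol hl hL b hα g p p'
      have e3 : inner ℝ (Q g) (M.meanFeature π - M.meanFeature (polAt pol p))
          = inner ℝ (Q g) (M.meanFeature π - M.meanFeature (polAt pol p'))
            + inner ℝ (Q g) (M.meanFeature (polAt pol p') - M.meanFeature (polAt pol p)) := by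
        rw [← inner_add_right]; congr 1; abel
      rw [e3]
      exact add_le_add e1 e2
    have h2 := integral_mono (μ := oracle ε δ' (Q g)) (integrable_const _)
      (hsi.add ((integrable_const (α / 2 * ‖g‖ ^ 2)).add hmi)) hpt
    simp only [Pi.add_apply] at h2
    have hci : Integrable (fun p' => α / 2 * ‖g‖ ^ 2 + meanQf M pol V p p' / (2 * α))
      (oracle ε δ' (Q g)) := (integrable_const _).add hmi
    rw [integral_add hsi hci, integral_add (integrable_const _) hmi, integral_div] at h2
    simp only [integral_const, probReal_univ, smul_eq_mul, one_mul] at h2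
    change _ ≤ _ + (_ + G g / _) at h2
    linarith
  -- The left side is `max(a₁, a₂) = (a₁ + a₂)/2 + |a₁ - a₂|/2`, where `aᵢ` is the left side of
  -- `hstep` for `πᵢ`.
  have hpt : ∀ g : E d, inner ℝ g (Q w) + 1 / 2 * |inner ℝ g (Q u)|
      ≤ ε + δ' * (‖g‖ * R) + α / 2 * ‖g‖ ^ 2 + G g / (2 * α) := by
    intro g
    rw [← inner_toEuclideanCLM_sqrt, ← inner_toEuclideanCLM_sqrt, ← hQ]
    have h1 := hstep g π₁
    have h2 := hstep g π₂
    simp only [w, u, inner_sub_right, inner_smul_right, inner_add_right] at h1 h2 ⊢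
    rcases abs_cases (inner ℝ (Q g) (M.meanFeature π₁) - inner ℝ (Q g) (M.meanFeature π₂))
      with ⟨h, _⟩ | ⟨h, _⟩ <;> rw [h] <;> linarith
  have i1 := integrable_inner_stdGaussian (Q w)
  have i2 := ((integrable_inner_stdGaussian (Q u)).abs).const_mul (1 / 2)
  have i3 : Integrable (fun g : E d => δ' * (‖g‖ * R)) (stdGaussian (E d)) :=
    (integrable_norm_stdGaussian.mul_const R).const_mul δ'
  have i4 : Integrable (fun g : E d => α / 2 * ‖g‖ ^ 2) (stdGaussian (E d)) :=
    integrable_norm_sq_stdGaussian.const_mul _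
  have i5 := hGi.div_const (2 * α)
  have i6 : Integrable (fun g : E d => ε + δ' * (‖g‖ * R)) (stdGaussian (E d)) :=
    (integrable_const ε).add i3
  have i7 : Integrable (fun g : E d => ε + δ' * (‖g‖ * R) + α / 2 * ‖g‖ ^ 2)
    (stdGaussian (E d)) := i6.add i4
  have hfin := integral_mono (i1.add i2) (i7.add i5) hpt
  simp only [Pi.add_apply] at hfin
  rw [integral_add i1 i2, integral_inner_stdGaussian, integral_const_mul,
    integral_abs_inner_stdGaussian, integral_add i7 i5, integral_add i6 i4] at hfin
  rw [integral_add (integrable_const ε) i3, integral_const_mul, integral_const_mul,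
    integral_mul_const, integral_norm_sq_stdGaussian, integral_div] at hfin
  simp only [integral_const, probReal_univ, smul_eq_mul, one_mul] at hfin
  have hu : √(qf V u) = ‖Q u‖ := by
    rw [qf, ← norm_sq_toEuclideanCLM_sqrt hV.inv.posSemidef, Real.sqrt_sq (norm_nonneg _)]
  rw [hu]
  have hn := mul_le_mul_of_nonneg_right (integral_norm_stdGaussian_le hd) (mul_nonneg hR hδ.le)
  linarith

end OneStep

/-! ### A supermartingale controlling the width after exploration. -/

section Exploration

variable {S A Pol : Type*} [MeasurableSpace S] [MeasurableSpace A] [MeasurableSpace Pol] {d : ℕ}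
  (M : FeatureMDP S A d) {lam : ℝ} {t : ℕ} {L : ℝ}
  (pol : Kernel (Pol × S) A) [IsMarkovKernel pol]
  (oracle : ℝ → ℝ → Kernel (E d) Pol) [∀ ε δ, IsMarkovKernel (oracle ε δ)]

/-- Differences of expected features of two policies. -/
def featureDiffs : Set (E d) :=
  Set.range fun q : Policy S A × Policy S A => M.meanFeature q.1 - M.meanFeature q.2

/-- The largest dual norm of a direction in `D`. -/
def width (D : Set (E d)) (V : Matrix (Fin d) (Fin d) ℝ) : ℝ := ⨆ u : D, √(qf V u)

lemma sqrt_qf_le (hl : 0 < lam) (hL : ∀ s a, ‖M.φ (s, a)‖ ≤ L) (b : Buffer S A t) {u : E d}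
    (hu : u ∈ featureDiffs M) : √(qf (designMatrix M lam b) u) ≤ 2 * L * M.horizon / √lam := by
  obtain ⟨q, rfl⟩ := hu
  have hL0 := M.nonneg_of_norm_le hL q.1
  have hH := M.horizon_pos
  exact Real.sqrt_le_iff.2
    ⟨by positivity, qf_designMatrix_le M hl b (M.norm_meanFeature_sub_le hL _ _)⟩

lemma bddAbove_sqrt_qf (hl : 0 < lam) (hL : ∀ s a, ‖M.φ (s, a)‖ ≤ L) (b : Buffer S A t)
    {D : Set (E d)} (hD : D ⊆ featureDiffs M) :
    BddAbove (Set.range fun u : D => √(qf (designMatrix M lam b) u)) := by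
  refine ⟨2 * L * M.horizon / √lam, ?_⟩
  rintro _ ⟨u, rfl⟩
  exact sqrt_qf_le M hl hL b (hD u.2)

lemma measurable_width (lam : ℝ) {D : Set (E d)} (hc : D.Countable) :
    Measurable fun b : Buffer S A t => width D (designMatrix M lam b) := by
  have := hc.to_subtype
  exact Measurable.iSup fun u => (measurable_qf_designMatrix M lam u.1).sqrt

/-- Monotonicity of the width lets the final width bound the gain rate of every earlier round. -/
lemma width_snoc_le (hl : 0 < lam) (hL : ∀ s a, ‖M.φ (s, a)‖ ≤ L) {D : Set (E d)}
    (hD : D ⊆ featureDiffs M) (b : Buffer S A t) (z : Traj S A × Traj S A) :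
    width D (designMatrix M lam (Fin.snoc b z : Buffer S A (t + 1)))
      ≤ width D (designMatrix M lam b) :=
  ciSup_mono (bddAbove_sqrt_qf M hl hL b hD)
    fun u => Real.sqrt_le_sqrt (qf_designMatrix_snoc_le M hl b z u)

/-- By continuity of the dual norm, the supremum over a countable dense set, which is measurable in
the buffer, already dominates every feature difference. -/
lemma sqrt_qf_le_width (hl : 0 < lam) (hL : ∀ s a, ‖M.φ (s, a)‖ ≤ L) {D : Set (E d)}
    (hD : D ⊆ featureDiffs M) (hdense : featureDiffs M ⊆ closure D) (b : Buffer S A t) {u : E d}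
    (hu : u ∈ featureDiffs M) :
    √(qf (designMatrix M lam b) u) ≤ width D (designMatrix M lam b) := by
  have hc : Continuous fun u : E d => √(qf (designMatrix M lam b) u) := by
    unfold qf; fun_prop
  have hcl : IsClosed {u : E d | √(qf (designMatrix M lam b) u) ≤ width D (designMatrix M lam b)} :=
    isClosed_le hc continuous_const
  refine closure_minimal (fun v hv => ?_) hcl (hdense hu)
  exact le_ciSup (bddAbove_sqrt_qf M hl hL b hD) ⟨v, hv⟩

/-- The guaranteed logarithmic information gain of a round when the current width is `W`. -/
def gainRate (d : ℕ) (R ε δ' α W : ℝ) : ℝ :=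
  α / (1 + R ^ 2) * (absMoment * W - 2 * (ε + √d * R * δ') - α * d)

lemma gainRate_mono {d : ℕ} {R ε δ' α W W' : ℝ} (hα : 0 < α) (h : W ≤ W') :
    gainRate d R ε δ' α W ≤ gainRate d R ε δ' α W' := by
  have := absMoment_pos
  unfold gainRate
  gcongr

/-- The one-round inequality solved for the expected gain. Division by `1 + R²` turns `xᵀV⁻¹x`,
which is at most `R²`, into a lower bound on the logarithmic growth of the determinant. -/
lemma gainRate_width_le (hd : 1 ≤ d) (hl : 0 < lam) (hL : ∀ s a, ‖M.φ (s, a)‖ ≤ L)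
    (hO : IsPACOracle M pol oracle) {ε δ' α : ℝ} (hε : 0 < ε) (hδ : 0 < δ') (hδ1 : δ' < 1)
    (hα : 0 < α) (p : Pol) (b : Buffer S A t) {D : Set (E d)} (hD : D ⊆ featureDiffs M)
    (hne : D.Nonempty) :
    gainRate d (2 * L * M.horizon / √lam) ε δ' α (width D (designMatrix M lam b))
      ≤ roundQf M pol oracle lam ε δ' p b / (1 + (2 * L * M.horizon / √lam) ^ 2) := by
  set R := 2 * L * M.horizon / √lam
  set m := roundQf M pol oracle lam ε δ' p b
  have := hne.to_subtype
  have hc := absMoment_pos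
  have hW : width D (designMatrix M lam b)
      ≤ (2 * (ε + √d * R * δ') + α * d + m / α) / absMoment := by
    refine ciSup_le fun u => ?_
    obtain ⟨⟨π₁, π₂⟩, hu⟩ := hD u.2
    have h := sqrt_qf_le_roundQf M pol oracle hd hl hL hO hε hδ hδ1 hα p b π₁ π₂
    simp only at hu
    rw [hu] at h
    change _ ≤ ε + √d * R * δ' + _ + m / (2 * α) at h
    rw [le_div_iff₀ hc]
    have e : m / (2 * α) = m / α / 2 := by field_simp
    rw [e] at h
    linarith
  rw [le_div_iff₀ hc] at hW
  have h2 : α * (absMoment * width D (designMatrix M lam b) - 2 * (ε + √d * R * δ') - α * d)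
      ≤ m := by
    rw [← le_div_iff₀' hα]
    linarith
  rw [gainRate, div_mul_eq_mul_div]
  gcongr

lemma lintegral_one_add_qf_inv_le (hl : 0 < lam) (hL : ∀ s a, ‖M.φ (s, a)‖ ≤ L) (ε δ' : ℝ)
    (p : Pol) (b : Buffer S A t) :
    ∫⁻ q, ENNReal.ofReal (1 + qf (designMatrix M lam b) (designPoint M q.2))⁻¹
      ∂((policyUpdate M oracle lam ε δ' t ⊗ₖ pairSampling M pol t) (p, b))
      ≤ ENNReal.ofReal (Real.exp (-(roundQf M pol oracle lam ε δ' p b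
          / (1 + (2 * L * M.horizon / √lam) ^ 2)))) := by
  set R := 2 * L * M.horizon / √lam
  set V := designMatrix M lam b
  set ρ := (policyUpdate M oracle lam ε δ' t ⊗ₖ pairSampling M pol t) (p, b)
  have hm : Measurable fun q : Pol × (Traj S A × Traj S A) => qf V (designPoint M q.2) :=
    (measurable_qf_designPoint M V).comp measurable_snd
  have h0 : ∀ q : Pol × (Traj S A × Traj S A), 0 ≤ qf V (designPoint M q.2) :=
    fun q => qf_nonneg (posDef_designMatrix M hl b) _
  have hq : ∀ q : Pol × (Traj S A × Traj S A), qf V (designPoint M q.2) ≤ R ^ 2 :=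
    fun q => qf_designMatrix_le M hl b (M.norm_designPoint_le hL _)
  have hi : Integrable (fun q : Pol × (Traj S A × Traj S A) => qf V (designPoint M q.2)) ρ :=
    Integrable.of_bound hm.aestronglyMeasurable (R ^ 2)
      (ae_of_all _ fun q => by rw [Real.norm_of_nonneg (h0 q)]; exact hq q)
  -- The chord of the convex function `q ↦ 1/(1 + q)` on `[0, R²]` lies above its graph; together
  -- with `1 - y ≤ exp(-y)` this gives the exponential bound.
  have hlin : ∀ q : Pol × (Traj S A × Traj S A), (1 + qf V (designPoint M q.2))⁻¹
      ≤ 1 - qf V (designPoint M q.2) / (1 + R ^ 2) := by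
    intro q
    have e : 1 - qf V (designPoint M q.2) / (1 + R ^ 2)
        = (1 + R ^ 2 - qf V (designPoint M q.2)) / (1 + R ^ 2) := by
      field_simp
    have hpos : 0 < 1 + qf V (designPoint M q.2) := by linarith [h0 q]
    rw [e, inv_eq_one_div, div_le_div_iff₀ hpos (by positivity)]
    nlinarith [h0 q, hq q]
  calc ∫⁻ q, ENNReal.ofReal (1 + qf V (designPoint M q.2))⁻¹ ∂ρ
      ≤ ∫⁻ q, ENNReal.ofReal (1 - qf V (designPoint M q.2) / (1 + R ^ 2)) ∂ρ :=
        lintegral_mono fun q => ENNReal.ofReal_le_ofReal (hlin q)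
    _ = ENNReal.ofReal (∫ q, (1 - qf V (designPoint M q.2) / (1 + R ^ 2)) ∂ρ) := by
        have hi' : Integrable (fun q : Pol × (Traj S A × Traj S A) =>
            1 - qf V (designPoint M q.2) / (1 + R ^ 2)) ρ :=
          (integrable_const _).sub (hi.div_const _)
        rw [ofReal_integral_eq_lintegral_ofReal hi']
        refine ae_of_all _ fun q => le_trans ?_ (hlin q)
        exact inv_nonneg.2 (by linarith [h0 q])
    _ ≤ _ := by
        refine ENNReal.ofReal_le_ofReal ?_
        rw [integral_sub (integrable_const _) (hi.div_const _), integral_div]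
        simp only [integral_const, probReal_univ, smul_eq_mul, one_mul]
        have := Real.add_one_le_exp (-(roundQf M pol oracle lam ε δ' p b / (1 + R ^ 2)))
        change 1 - roundQf M pol oracle lam ε δ' p b / (1 + R ^ 2) ≤ _
        linarith

/-- The potential `exp (t · gain(width)) / det V` of a buffer. -/
def potential (lam ε δ' α R : ℝ) (D : Set (E d)) (b : Buffer S A t) : ℝ :=
  Real.exp (t * gainRate d R ε δ' α (width D (designMatrix M lam b))) / (designMatrix M lam b).det

lemma measurable_potential (lam ε δ' α R : ℝ) {D : Set (E d)} (hc : D.Countable) :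
    Measurable (potential M lam ε δ' α R D : Buffer S A t → ℝ) := by
  have h := measurable_width M (t := t) lam hc
  have h2 := measurable_det_designMatrix M (t := t) lam
  unfold potential gainRate
  fun_prop

lemma lintegral_exploreRound (lam ε δ' : ℝ) (p : Pol) (b : Buffer S A t)
    {f : Pol × Buffer S A (t + 1) → ℝ≥0∞} (hf : Measurable f) :
    ∫⁻ q, f q ∂(exploreRound M pol oracle lam ε δ' t (p, b))
      = ∫⁻ q, f (q.1, Fin.snoc b q.2)
        ∂((policyUpdate M oracle lam ε δ' t ⊗ₖ pairSampling M pol t) (p, b)) := by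
  have hf' : Measurable fun q : (Pol × Buffer S A t) × (Pol × (Traj S A × Traj S A)) =>
      f (appendRound q) := hf.comp measurable_appendRound
  rw [exploreRound, Kernel.lintegral_map _ measurable_appendRound _ hf,
    Kernel.lintegral_id_prod hf']
  rfl

/-- The supermartingale step. The new width may be replaced by the old one, the determinant
contributes the factor `(1 + q)⁻¹`, and the mean of that factor is at most `exp(-gainRate)`, which
pays for the extra round in the exponent. -/
lemma lintegral_potential_exploreRound_le (hd : 1 ≤ d) (hl : 0 < lam)
    (hL : ∀ s a, ‖M.φ (s, a)‖ ≤ L) (hO : IsPACOracle M pol oracle) {ε δ' α : ℝ} (hε : 0 < ε)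
    (hδ : 0 < δ') (hδ1 : δ' < 1) (hα : 0 < α) {D : Set (E d)} (hD : D ⊆ featureDiffs M)
    (hne : D.Nonempty) (hc : D.Countable) (p : Pol) (b : Buffer S A t) :
    ∫⁻ q, ENNReal.ofReal (potential M lam ε δ' α (2 * L * M.horizon / √lam) D q.2)
      ∂(exploreRound M pol oracle lam ε δ' t (p, b))
      ≤ ENNReal.ofReal (potential M lam ε δ' α (2 * L * M.horizon / √lam) D b) := by
  set R := 2 * L * M.horizon / √lam
  have hm : Measurable fun q : Pol × Buffer S A (t + 1) =>
      ENNReal.ofReal (potential M lam ε δ' α R D q.2) :=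
    ((measurable_potential M lam ε δ' α R hc).comp measurable_snd).ennreal_ofReal
  rw [lintegral_exploreRound M pol oracle lam ε δ' p b hm]
  set V := designMatrix M lam b with hVdef
  have hV : V.PosDef := posDef_designMatrix M hl b
  have hdet := hV.det_pos
  set a := gainRate d R ε δ' α (width D V)
  have hpt : ∀ q : Pol × (Traj S A × Traj S A),
      ENNReal.ofReal (potential M lam ε δ' α R D (Fin.snoc b q.2 : Buffer S A (t + 1)))
      ≤ ENNReal.ofReal (Real.exp ((t + 1 : ℕ) * a) / V.det)
        * ENNReal.ofReal (1 + qf V (designPoint M q.2))⁻¹ := by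
    intro q
    have h1 : 0 < 1 + qf V (designPoint M q.2) := by linarith [qf_nonneg hV (designPoint M q.2)]
    rw [← ENNReal.ofReal_mul (by positivity)]
    refine ENNReal.ofReal_le_ofReal ?_
    rw [potential, det_designMatrix_snoc M hl, ← hVdef, ← div_eq_mul_inv, div_div]
    gcongr
    exact gainRate_mono hα (width_snoc_le M hl hL hD b q.2)
  refine (lintegral_mono hpt).trans ?_
  rw [lintegral_const_mul' _ _ ENNReal.ofReal_ne_top]
  refine (mul_le_mul_right (lintegral_one_add_qf_inv_le M pol oracle hl hL ε δ' p b) _).trans ?_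
  rw [← ENNReal.ofReal_mul (by positivity)]
  refine ENNReal.ofReal_le_ofReal ?_
  have hrate := gainRate_width_le M pol oracle hd hl hL hO hε hδ hδ1 hα p b hD hne
  rw [potential, div_mul_eq_mul_div, ← Real.exp_add]
  gcongr
  change a ≤ _ at hrate
  push_cast
  linarith

lemma lintegral_potential_exploreLaw_le (hd : 1 ≤ d) (hl : 0 < lam)
    (hL : ∀ s a, ‖M.φ (s, a)‖ ≤ L) (hO : IsPACOracle M pol oracle) {ε δ' α : ℝ} (hε : 0 < ε)
    (hδ : 0 < δ') (hδ1 : δ' < 1) (hα : 0 < α) {D : Set (E d)} (hD : D ⊆ featureDiffs M)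
    (hne : D.Nonempty) (hc : D.Countable) (p₀ : Pol) (t : ℕ) :
    ∫⁻ q, ENNReal.ofReal (potential M lam ε δ' α (2 * L * M.horizon / √lam) D q.2)
      ∂(exploreLaw M pol oracle lam ε δ' p₀ t) ≤ ENNReal.ofReal (lam ^ d)⁻¹ := by
  have hm : ∀ t, Measurable fun q : Pol × Buffer S A t =>
      ENNReal.ofReal (potential M lam ε δ' α (2 * L * M.horizon / √lam) D q.2) := fun t =>
    ((measurable_potential M lam ε δ' α _ hc).comp measurable_snd).ennreal_ofReal
  induction t with
  | zero =>
    rw [exploreLaw, lintegral_dirac' _ (hm 0)]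
    -- At `t = 0` the factor `t` kills the exponent and the determinant is `lam ^ d`.
    simp [potential, designMatrix]
  | succ t ih =>
    rw [exploreLaw, Measure.lintegral_bind (Kernel.aemeasurable _) (hm _).aemeasurable]
    refine le_trans (lintegral_mono fun s => ?_) ih
    exact lintegral_potential_exploreRound_le M pol oracle hd hl hL hO hε hδ hδ1 hα hD hne hc s.1 s.2

/-- With high probability, the dual norms of all feature differences are small after exploration. -/
lemma exists_explored_event (hd : 1 ≤ d) (hl : 0 < lam)
    (hL : ∀ s a, ‖M.φ (s, a)‖ ≤ L) (hO : IsPACOracle M pol oracle) {ε δ' α δ₁ : ℝ} (hε : 0 < ε)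
    (hδ : 0 < δ') (hδ1 : δ' < 1) (hα : 0 < α) (hδ₁ : 0 < δ₁) (p₀ : Pol) (T : ℕ) :
    ∃ G : Set (Buffer S A T), MeasurableSet G ∧
      ENNReal.ofReal (1 - δ₁) ≤ (exploreLaw M pol oracle lam ε δ' p₀ T).map Prod.snd G ∧
      ∀ b ∈ G, ∀ π₁ π₂ : Policy S A,
        T * gainRate d (2 * L * M.horizon / √lam) ε δ' α
          √(qf (designMatrix M lam b) (M.meanFeature π₁ - M.meanFeature π₂))
        ≤ Real.log (1 / δ₁) + d * Real.log (1 + T * (2 * L * M.horizon / √lam) ^ 2) := by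
  set R := 2 * L * M.horizon / √lam
  obtain ⟨D, hD, hc, hdense⟩ := (TopologicalSpace.IsSeparable.of_separableSpace
    (featureDiffs M)).exists_countable_dense_subset
  have hne : D.Nonempty := by
    have : (closure D).Nonempty :=
      ⟨_, hdense ⟨(polAt pol p₀, polAt pol p₀), rfl⟩⟩
    exact closure_nonempty_iff.1 this
  set F : Buffer S A T → ℝ := potential M lam ε δ' α R D
  have hF : Measurable F := measurable_potential M lam ε δ' α R hc
  set μ := (exploreLaw M pol oracle lam ε δ' p₀ T).map Prod.snd with hμ
  have : IsProbabilityMeasure μ := Measure.isProbabilityMeasure_map measurable_snd.aemeasurable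
  have hint : ∫⁻ b, ENNReal.ofReal (F b) ∂μ ≤ ENNReal.ofReal (lam ^ d)⁻¹ := by
    rw [hμ, lintegral_map hF.ennreal_ofReal measurable_snd]
    exact lintegral_potential_exploreLaw_le M pol oracle hd hl hL hO hε hδ hδ1 hα hD hne hc p₀ T
  have hG : MeasurableSet {b | F b < (lam ^ d)⁻¹ / δ₁} := hF measurableSet_Iio
  refine ⟨{b | F b < (lam ^ d)⁻¹ / δ₁}, hG, ?_, ?_⟩
  -- Markov's inequality for the potential, whose mean never exceeds its initial value.
  · have hbad : μ {b | F b < (lam ^ d)⁻¹ / δ₁}ᶜ ≤ ENNReal.ofReal δ₁ := by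
      have hsub : {b | F b < (lam ^ d)⁻¹ / δ₁}ᶜ
          ⊆ {b | ENNReal.ofReal ((lam ^ d)⁻¹ / δ₁) ≤ ENNReal.ofReal (F b)} := by
        intro b hb
        exact ENNReal.ofReal_le_ofReal (not_lt.1 hb)
      refine (measure_mono hsub).trans ?_
      have hpos : 0 < (lam ^ d)⁻¹ / δ₁ := by positivity
      refine (meas_ge_le_lintegral_div hF.ennreal_ofReal.aemeasurable
        (ENNReal.ofReal_pos.2 hpos).ne' ENNReal.ofReal_ne_top).trans ?_
      refine (ENNReal.div_le_div_right hint _).trans ?_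
      rw [← ENNReal.ofReal_div_of_pos hpos]
      refine ENNReal.ofReal_le_ofReal (le_of_eq ?_)
      field_simp
    rw [ENNReal.ofReal_sub _ hδ₁.le, ENNReal.ofReal_one]
    rw [tsub_le_iff_right, ← prob_add_prob_compl hG (μ := μ)]
    gcongr
  · intro b hb π₁ π₂
    have hV := posDef_designMatrix M hl b
    have hdet := hV.det_pos
    have hb' : Real.exp (T * gainRate d R ε δ' α (width D (designMatrix M lam b)))
        < (lam ^ d)⁻¹ / δ₁ * (designMatrix M lam b).det := by
      have : F b < (lam ^ d)⁻¹ / δ₁ := hb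
      rwa [← div_lt_iff₀ hdet]
    have hle : (lam ^ d)⁻¹ / δ₁ * (designMatrix M lam b).det ≤ 1 / δ₁ * (1 + T * R ^ 2) ^ d := by
      have h := det_designMatrix_le M hl hL b
      rw [mul_pow] at h
      calc (lam ^ d)⁻¹ / δ₁ * (designMatrix M lam b).det
          ≤ (lam ^ d)⁻¹ / δ₁ * (lam ^ d * (1 + T * R ^ 2) ^ d) := by gcongr
        _ = _ := by field_simp
    have h3 := (Real.lt_log_iff_exp_lt (by positivity)).2 (hb'.trans_le hle)
    rw [Real.log_mul (by positivity) (by positivity), Real.log_pow] at h3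
    refine le_trans ?_ h3.le
    gcongr
    exact gainRate_mono hα (sqrt_qf_le_width M hl hL hD hdense b ⟨(π₁, π₂), rfl⟩)

end Exploration

/-! ### The logistic model: strong convexity and Hellinger affinity. -/

section Logistic

/-- The log-partition function `log (1 + exp u)` of the Bernoulli family. -/
def softplus (u : ℝ) : ℝ := Real.log (1 + Real.exp u)

lemma log_sigmoid_neg (u : ℝ) : Real.log (Real.sigmoid (-u)) = -softplus u := by
  rw [Real.sigmoid_def, neg_neg, Real.log_inv, softplus]

lemma softplus_neg (u : ℝ) : softplus (-u) = softplus u - u := by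
  have h : 1 + Real.exp (-u) = (1 + Real.exp u) * Real.exp (-u) := by
    rw [add_mul, ← Real.exp_add]; simp [add_comm]
  rw [softplus, h, Real.log_mul (by positivity) (by positivity), Real.log_exp, softplus]
  ring

lemma log_sigmoid (u : ℝ) : Real.log (Real.sigmoid u) = u - softplus u := by
  have := log_sigmoid_neg (-u)
  rw [neg_neg, softplus_neg] at this
  rw [this]; ring

lemma softplus_le (u v : ℝ) : softplus u ≤ softplus v + |u - v| := by
  rw [softplus, softplus, ← Real.log_exp |u - v|, ← Real.log_mul (by positivity) (by positivity)]
  refine Real.log_le_log (by positivity) ?_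
  have h1 : Real.exp u ≤ Real.exp v * Real.exp |u - v| := by
    rw [← Real.exp_add]
    exact Real.exp_le_exp.2 (by linarith [le_abs_self (u - v)])
  have h2 : 1 ≤ Real.exp |u - v| := Real.one_le_exp (abs_nonneg _)
  linarith

lemma hasDerivAt_softplus (u : ℝ) : HasDerivAt softplus (Real.sigmoid u) u := by
  have h := ((Real.hasDerivAt_exp u).const_add 1).log (by positivity)
  have e : Real.sigmoid u = Real.exp u / (1 + Real.exp u) := by
    rw [Real.sigmoid_def, Real.exp_neg]
    field_simp
    ring
  rw [e]
  exact h

variable {d : ℕ} {B R : ℝ}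

/-- Needed because `kappa` is a real `sSup`, which would be `0` on an unbounded set. Both `σ(u)` and
`1 - σ(u) = σ(-u)` are at least `σ(-BR)` when `|u| ≤ BR`. -/
lemma bddAbove_kappa (d : ℕ) (B R : ℝ) : BddAbove {r | ∃ θ x : E d, ‖θ‖ ≤ B ∧ ‖x‖ ≤ R ∧
    r = 1 / deriv Real.sigmoid (inner ℝ θ x)} := by
  refine ⟨1 / Real.sigmoid (-(B * R)) ^ 2, ?_⟩
  rintro _ ⟨θ, x, hθ, hx, rfl⟩
  have hB : 0 ≤ B := (norm_nonneg _).trans hθ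
  have h := (abs_real_inner_le_norm θ x).trans (mul_le_mul hθ hx (norm_nonneg _) hB)
  simp only [Real.deriv_sigmoid]
  rw [← Real.sigmoid_neg]
  have hp := Real.sigmoid_pos (-(B * R))
  have h1 := Real.sigmoid_le (neg_le_of_abs_le h)
  have h2 := Real.sigmoid_le (neg_le_neg (le_of_abs_le h))
  rw [sq]
  gcongr
  exact (Real.sigmoid_pos _).le

lemma inv_kappa_le (θ x : E d) (hθ : ‖θ‖ ≤ B) (hx : ‖x‖ ≤ R) :
    (kappa d B R)⁻¹ ≤ Real.sigmoid (inner ℝ θ x) * (1 - Real.sigmoid (inner ℝ θ x)) := by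
  have h : 1 / deriv Real.sigmoid (inner ℝ θ x) ≤ kappa d B R :=
    le_csSup (bddAbove_kappa d B R) ⟨θ, x, hθ, hx, rfl⟩
  rw [Real.deriv_sigmoid, one_div] at h
  have hp : 0 < Real.sigmoid (inner ℝ θ x) * (1 - Real.sigmoid (inner ℝ θ x)) :=
    mul_pos (Real.sigmoid_pos _) (by linarith [Real.sigmoid_lt_one (inner ℝ θ x)])
  exact inv_le_of_inv_le₀ hp h

lemma four_le_kappa (hB : 0 ≤ B) (hR : 0 ≤ R) : 4 ≤ kappa d B R := by
  refine le_csSup (bddAbove_kappa d B R) ⟨0, 0, by simpa, by simpa, ?_⟩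
  simp only [inner_zero_left, Real.deriv_sigmoid, Real.sigmoid_zero]
  norm_num

/-- Strong midpoint convexity of the log-partition function on the relevant range. -/
lemma softplus_midpoint_le {θ θ' x : E d} (hθ : ‖θ‖ ≤ B) (hθ' : ‖θ'‖ ≤ B) (hx : ‖x‖ ≤ R) :
    softplus ((inner ℝ θ x + inner ℝ θ' x) / 2)
      ≤ (softplus (inner ℝ θ x) + softplus (inner ℝ θ' x)) / 2
        - (inner ℝ θ x - inner ℝ θ' x) ^ 2 / (8 * kappa d B R) := by
  set k := kappa d B R
  have hk : 0 < k := by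
    have := four_le_kappa (d := d) ((norm_nonneg _).trans hθ) ((norm_nonneg _).trans hx)
    linarith
  set I : Set ℝ := (fun θ : E d => inner ℝ θ x) '' Metric.closedBall 0 B with hI
  have hconv : Convex ℝ I := by
    have e : (fun θ : E d => inner ℝ θ x) = ⇑(innerSL ℝ x).toLinearMap := by
      ext θ; simp [real_inner_comm]
    rw [hI, e]
    exact (convex_closedBall 0 B).linear_image _
  have hd1 : ∀ u : ℝ, HasDerivAt (fun u => softplus u - u ^ 2 / (2 * k))
      (Real.sigmoid u - u / k) u := by
    intro u
    have h := (hasDerivAt_softplus u).sub ((hasDerivAt_pow 2 u).div_const (2 * k))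
    have e : u / k = ((2 : ℕ) * u ^ (2 - 1)) / (2 * k) := by
      field_simp
      norm_num [mul_comm]
    rw [e]
    exact h
  have hd2 : ∀ u : ℝ, HasDerivAt (fun u => Real.sigmoid u - u / k)
      (Real.sigmoid u * (1 - Real.sigmoid u) - 1 / k) u := fun u =>
    (Real.hasDerivAt_sigmoid u).sub ((hasDerivAt_id u).div_const k)
  -- The second derivative `σ' - 1/κ` is nonnegative on the interval `I` of attainable values `⟨θ,
  -- x⟩`, by the definition of `κ`. Convexity at the midpoint then yields the constant `8`.
  have hc : ConvexOn ℝ I fun u => softplus u - u ^ 2 / (2 * k) := by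
    refine convexOn_of_hasDerivWithinAt2_nonneg hconv
      (fun u _ => (hd1 u).continuousAt.continuousWithinAt)
      (fun u _ => (hd1 u).hasDerivWithinAt) (fun u _ => (hd2 u).hasDerivWithinAt) fun u hu => ?_
    obtain ⟨θ₀, h0, rfl⟩ := interior_subset hu
    have := inv_kappa_le θ₀ x (by simpa using h0) hx
    rw [one_div]
    linarith
  have hI1 : inner ℝ θ x ∈ I := ⟨θ, by simpa using hθ, rfl⟩
  have hI2 : inner ℝ θ' x ∈ I := ⟨θ', by simpa using hθ', rfl⟩
  have h := hc.2 hI1 hI2 (by norm_num : (0 : ℝ) ≤ 1 / 2) (by norm_num : (0 : ℝ) ≤ 1 / 2)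
    (by norm_num)
  simp only [smul_eq_mul] at h
  generalize inner ℝ θ x = a at h ⊢
  generalize inner ℝ θ' x = b at h ⊢
  have e : 1 / 2 * a + 1 / 2 * b = (a + b) / 2 := by ring
  rw [e] at h
  have e2 : (a - b) ^ 2 / (8 * k) = 1 / 2 * (a ^ 2 / (2 * k)) + 1 / 2 * (b ^ 2 / (2 * k))
      - ((a + b) / 2) ^ 2 / (2 * k) := by
    field_simp
    ring
  rw [e2]
  linarith

/-- The log-likelihood of one label. -/
def logLik (u : ℝ) (y : Bool) : ℝ :=
  if y then Real.log (Real.sigmoid u) else Real.log (Real.sigmoid (-u))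

/-- The log-likelihood is 1-Lipschitz in the logit, which controls its change when the estimator is
perturbed. -/
lemma logLik_le (u v : ℝ) (y : Bool) : logLik u y ≤ logLik v y + |u - v| := by
  cases y
  · simp only [logLik, Bool.false_eq_true, if_false, log_sigmoid_neg]
    have := softplus_le v u
    rw [abs_sub_comm] at this
    linarith
  · simp only [logLik, if_true]
    have := softplus_le (-v) (-u)
    rw [softplus_neg, softplus_neg, show -v - -u = u - v by ring] at this
    rw [log_sigmoid, log_sigmoid]
    linarith

lemma integral_bernoulli_sigmoid (a : ℝ) (f : Bool → ℝ) :
    ∫ y, f y ∂(bernoulliMeasure true false (unitInterval.sigmoid a))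
      = Real.sigmoid a * f true + Real.sigmoid (-a) * f false := by
  rw [integral_bernoulliMeasure, Real.sigmoid_neg]
  rfl

/-- The Hellinger affinity of two Bradley–Terry label laws. -/
lemma integral_exp_half_logLik_sub_le {θ θ' x : E d} (hθ : ‖θ‖ ≤ B) (hθ' : ‖θ'‖ ≤ B)
    (hx : ‖x‖ ≤ R) :
    ∫ y, Real.exp ((logLik (inner ℝ θ' x) y - logLik (inner ℝ θ x) y) / 2)
      ∂(bernoulliMeasure true false (unitInterval.sigmoid (inner ℝ θ x)))
      ≤ Real.exp (-((inner ℝ θ' x - inner ℝ θ x) ^ 2 / (8 * kappa d B R))) := by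
  rw [integral_bernoulli_sigmoid]
  have h := softplus_midpoint_le hθ hθ' hx
  rw [← sq_abs, abs_sub_comm, sq_abs] at h
  generalize inner ℝ θ x = a at h ⊢
  generalize inner ℝ θ' x = b at h ⊢
  simp only [logLik, if_true, Bool.false_eq_true, if_false]
  have ea : Real.sigmoid a = Real.exp (a - softplus a) := by
    rw [← log_sigmoid, Real.exp_log (Real.sigmoid_pos a)]
  have ea' : Real.sigmoid (-a) = Real.exp (-softplus a) := by
    rw [← log_sigmoid_neg, Real.exp_log (Real.sigmoid_pos (-a))]
  rw [log_sigmoid, log_sigmoid, log_sigmoid_neg, log_sigmoid_neg, ea, ea', ← Real.exp_add,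
    ← Real.exp_add]
  -- In exponential-family form both terms share the factor `exp(-(softplus a + softplus b)/2)`;
  -- what remains is `1 + exp((a + b)/2)`, the partition function at the midpoint.
  have e1 : a - softplus a + (b - softplus b - (a - softplus a)) / 2
      = (a + b) / 2 + -((softplus a + softplus b) / 2) := by ring
  have e2 : -softplus a + (-softplus b - -softplus a) / 2 = -((softplus a + softplus b) / 2) := by
    ring
  have e3 : Real.exp ((a + b) / 2) + 1 = Real.exp (softplus ((a + b) / 2)) := by
    rw [softplus, Real.exp_log (by positivity), add_comm]
  rw [e1, e2, Real.exp_add, ← add_one_mul, e3, ← Real.exp_add]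
  exact Real.exp_le_exp.2 (by linarith)

end Logistic

/-! ### A confidence ellipsoid for maximum likelihood by mixing likelihood ratios. -/

section Confidence

variable {d T : ℕ} {B R : ℝ}

lemma negLogLik_eq (x : Fin T → E d) (y : Fin T → Bool) (θ : E d) :
    negLogLik (fun i => (x i, y i)) θ = -∑ i, logLik (inner ℝ θ (x i)) (y i) := rfl

/-- The joint law of independent Bradley–Terry labels for the design points `x`. -/
def labelLaw (θs : E d) (x : Fin T → E d) : Measure (Fin T → Bool) :=
  Measure.pi fun i => bernoulliMeasure true false (unitInterval.sigmoid (inner ℝ θs (x i)))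

instance (θs : E d) (x : Fin T → E d) : IsProbabilityMeasure (labelLaw θs x) := by
  unfold labelLaw; infer_instance

/-- The exponent of the likelihood-ratio process, compensated by its Hellinger rate. -/
def ratioExponent (k : ℝ) (θs : E d) (x : Fin T → E d) (y : Fin T → Bool) (θ : E d) : ℝ :=
  (negLogLik (fun i => (x i, y i)) θs - negLogLik (fun i => (x i, y i)) θ) / 2
    + (∑ i, (inner ℝ (θ - θs) (x i)) ^ 2) / (8 * k)

/-- Independence factorizes the mean into Hellinger affinities, and the compensator cancels the
product of their bounds exactly. -/
lemma lintegral_ratioExponent_le {θs θ : E d} (hs : ‖θs‖ ≤ B) (hθ : ‖θ‖ ≤ B) {x : Fin T → E d}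
    (hx : ∀ i, ‖x i‖ ≤ R) :
    ∫⁻ y, ENNReal.ofReal (Real.exp (ratioExponent (kappa d B R) θs x y θ)) ∂(labelLaw θs x)
      ≤ 1 := by
  set k := kappa d B R
  have e : ∀ y, Real.exp (ratioExponent k θs x y θ)
      = (∏ i, Real.exp ((logLik (inner ℝ θ (x i)) (y i) - logLik (inner ℝ θs (x i)) (y i)) / 2))
        * Real.exp ((∑ i, (inner ℝ (θ - θs) (x i)) ^ 2) / (8 * k)) := by
    intro y
    rw [← Real.exp_sum, ← Real.exp_add, ratioExponent, negLogLik_eq, negLogLik_eq,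
      ← Finset.sum_div, Finset.sum_sub_distrib]
    ring_nf
  rw [← ofReal_integral_eq_lintegral_ofReal Integrable.of_finite
    (ae_of_all _ fun y => (Real.exp_pos _).le)]
  simp_rw [e]
  rw [integral_mul_const, labelLaw, integral_fintype_prod_eq_prod
    (f := fun i y => Real.exp ((logLik (inner ℝ θ (x i)) y - logLik (inner ℝ θs (x i)) y) / 2)),
    ENNReal.ofReal_le_one]
  have h : ∏ i, ∫ y, Real.exp ((logLik (inner ℝ θ (x i)) y - logLik (inner ℝ θs (x i)) y) / 2)
        ∂(bernoulliMeasure true false (unitInterval.sigmoid (inner ℝ θs (x i))))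
      ≤ ∏ i, Real.exp (-((inner ℝ θ (x i) - inner ℝ θs (x i)) ^ 2 / (8 * k))) :=
    Finset.prod_le_prod (fun i _ => integral_nonneg fun y => (Real.exp_pos _).le)
      fun i _ => integral_exp_half_logLik_sub_le hs hθ (hx i)
  refine (mul_le_mul_of_nonneg_right h (Real.exp_pos _).le).trans ?_
  rw [← Real.exp_sum, ← Real.exp_add, ← Real.exp_zero]
  refine Real.exp_le_exp.2 (le_of_eq ?_)
  simp_rw [inner_sub_left]
  rw [Finset.sum_neg_distrib, Finset.sum_div]
  ring

lemma continuous_ratioExponent (k : ℝ) (θs : E d) (x : Fin T → E d) (y : Fin T → Bool) :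
    Continuous (ratioExponent k θs x y) := by
  have h : ∀ y : Bool, Continuous fun u => logLik u y := by
    intro y
    have hs : Continuous softplus :=
      continuous_iff_continuousAt.2 fun u => (hasDerivAt_softplus u).continuousAt
    cases y
    · simp only [logLik, Bool.false_eq_true, if_false, log_sigmoid_neg]
      exact hs.neg
    · simp only [logLik, if_true, log_sigmoid]
      exact continuous_id.sub hs
  unfold ratioExponent
  simp_rw [negLogLik_eq]
  have h2 : ∀ i, Continuous fun θ : E d => logLik (inner ℝ θ (x i)) (y i) := fun i =>
    (h (y i)).comp (by fun_prop)
  fun_prop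

/-- The mixture of the likelihood-ratio process over the parameter ball. -/
def ratioMixture (B k : ℝ) (θs : E d) (x : Fin T → E d) (y : Fin T → Bool) : ℝ≥0∞ :=
  ∫⁻ θ in Metric.closedBall (0 : E d) B, ENNReal.ofReal (Real.exp (ratioExponent k θs x y θ))

/-- The label space is finite, so exchanging the two integrals is linearity of the integral over
`θ`. -/
lemma lintegral_ratioMixture_le {θs : E d} (hs : ‖θs‖ ≤ B) {x : Fin T → E d}
    (hx : ∀ i, ‖x i‖ ≤ R) :
    ∫⁻ y, ratioMixture B (kappa d B R) θs x y ∂(labelLaw θs x)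
      ≤ volume (Metric.closedBall (0 : E d) B) := by
  set k := kappa d B R
  have hm : ∀ y, Measurable fun θ => ENNReal.ofReal (Real.exp (ratioExponent k θs x y θ)) :=
    fun y => (Real.continuous_exp.comp (continuous_ratioExponent k θs x y)).measurable.ennreal_ofReal
  rw [lintegral_fintype]
  simp_rw [ratioMixture, ← lintegral_mul_const _ (hm _)]
  rw [← lintegral_finsetSum _ fun y _ => (hm y).mul_const _]
  simp_rw [← lintegral_fintype]
  refine (setLIntegral_mono measurable_const (g := fun _ => 1) fun θ hθ => ?_).trans (by simp)
  exact lintegral_ratioExponent_le hs (by simpa using hθ) hx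

/-- At the estimator the likelihood difference is nonnegative, so the exponent is at least the
compensator. Shrinking the ball towards it by `a` moves each logit by at most `2BRa`, hence the
whole log-likelihood by at most `1`. The total loss `1` is half from the likelihood and at most half
from the compensator, whose main term is also halved. -/
lemma ratioExponent_ge {θs θh : E d} {x : Fin T → E d} {y : Fin T → Bool} (hs : ‖θs‖ ≤ B)
    (hx : ∀ i, ‖x i‖ ≤ R) (hR : 0 ≤ R)
    (hh : IsMLE B (fun i => (x i, y i)) θh) {a : ℝ} (ha0 : 0 ≤ a) (ha : T * (2 * B * R * a) ≤ 1)
    {w : E d} (hw : ‖w‖ ≤ B) :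
    (∑ i, (inner ℝ (θh - θs) (x i)) ^ 2) / (16 * kappa d B R) - 1
      ≤ ratioExponent (kappa d B R) θs x y (AffineMap.homothety θh a w) := by
  set k := kappa d B R
  have hB : 0 ≤ B := (norm_nonneg _).trans hs
  have hk : 4 ≤ k := four_le_kappa hB hR
  set θ := AffineMap.homothety θh a w with hθ
  have hdiff : θ - θh = a • (w - θh) := by
    rw [hθ, AffineMap.homothety_apply]; simp
  set η := 2 * B * R * a
  have hη0 : 0 ≤ η := by positivity
  have hη : ∀ i, |inner ℝ (θ - θh) (x i)| ≤ η := by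
    intro i
    rw [hdiff, inner_smul_left, conj_trivial, abs_mul, abs_of_nonneg ha0]
    have h1 : ‖w - θh‖ ≤ 2 * B := (norm_sub_le _ _).trans (by linarith [hh.1])
    have h2 := (abs_real_inner_le_norm (w - θh) (x i)).trans
      (mul_le_mul h1 (hx i) (norm_nonneg _) (by positivity))
    calc a * |inner ℝ (w - θh) (x i)| ≤ a * (2 * B * R) := by gcongr
      _ = η := by ring
  have hη1 : T * η ^ 2 ≤ 1 := by
    rcases Nat.eq_zero_or_pos T with rfl | hT
    · simp
    · have : (1 : ℝ) ≤ T := by exact_mod_cast hT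
      nlinarith
  have h1 : negLogLik (fun i => (x i, y i)) θ ≤ negLogLik (fun i => (x i, y i)) θs + 1 := by
    have h2 := hh.2 θs hs
    rw [negLogLik_eq] at h2 ⊢
    have h3 : ∑ i, logLik (inner ℝ θh (x i)) (y i)
        ≤ ∑ i, (logLik (inner ℝ θ (x i)) (y i) + η) := by
      refine Finset.sum_le_sum fun i _ => (logLik_le _ (inner ℝ θ (x i)) _).trans ?_
      gcongr
      rw [abs_sub_comm, ← inner_sub_left]
      exact hη i
    rw [Finset.sum_add_distrib] at h3
    simp only [Finset.sum_const, Finset.card_univ, Fintype.card_fin, nsmul_eq_mul] at h3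
    linarith
  -- Termwise `(p + q)² ≥ q²/2 - p²`, with `p` the perturbation of the logit.
  have h4 : (∑ i, (inner ℝ (θh - θs) (x i)) ^ 2) / 2 - 1
      ≤ ∑ i, (inner ℝ (θ - θs) (x i)) ^ 2 := by
    have h5 : ∑ i, ((inner ℝ (θh - θs) (x i)) ^ 2 / 2 - η ^ 2)
        ≤ ∑ i, (inner ℝ (θ - θs) (x i)) ^ 2 := by
      refine Finset.sum_le_sum fun i _ => ?_
      have e : inner ℝ (θ - θs) (x i) = inner ℝ (θ - θh) (x i) + inner ℝ (θh - θs) (x i) := by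
        rw [← inner_add_left]; simp
      have h6 := pow_le_pow_left₀ (abs_nonneg _) (hη i) 2
      rw [sq_abs] at h6
      rw [e]
      nlinarith [sq_nonneg (2 * inner ℝ (θ - θh) (x i) + inner ℝ (θh - θs) (x i))]
    rw [Finset.sum_sub_distrib, ← Finset.sum_div] at h5
    simp only [Finset.sum_const, Finset.card_univ, Fintype.card_fin, nsmul_eq_mul] at h5
    linarith
  have h7 : ((∑ i, (inner ℝ (θh - θs) (x i)) ^ 2) / 2 - 1) / (8 * k)
      ≤ (∑ i, (inner ℝ (θ - θs) (x i)) ^ 2) / (8 * k) := by gcongr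
  have h8 : 1 / (8 * k) ≤ 1 / 2 := by
    rw [div_le_div_iff₀ (by positivity) (by norm_num)]; linarith
  have h9 : ((∑ i, (inner ℝ (θh - θs) (x i)) ^ 2) / 2 - 1) / (8 * k)
      = (∑ i, (inner ℝ (θh - θs) (x i)) ^ 2) / (16 * k) - 1 / (8 * k) := by
    field_simp
    ring
  rw [ratioExponent]
  linarith

/-- Keep only the homothetic copy of the ball centred at the estimator: convexity keeps it inside
the ball, and its volume is `a ^ d` times that of the ball. -/
lemma ratioMixture_ge {θs θh : E d} {x : Fin T → E d} {y : Fin T → Bool} (hs : ‖θs‖ ≤ B)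
    (hx : ∀ i, ‖x i‖ ≤ R) (hR : 0 ≤ R)
    (hh : IsMLE B (fun i => (x i, y i)) θh) {a : ℝ} (ha0 : 0 ≤ a) (ha1 : a ≤ 1)
    (ha : T * (2 * B * R * a) ≤ 1) :
    ENNReal.ofReal (Real.exp ((∑ i, (inner ℝ (θh - θs) (x i)) ^ 2) / (16 * kappa d B R) - 1)
      * a ^ d) * volume (Metric.closedBall (0 : E d) B)
      ≤ ratioMixture B (kappa d B R) θs x y := by
  set s := AffineMap.homothety θh a '' Metric.closedBall (0 : E d) B with hsdef
  have hsub : s ⊆ Metric.closedBall (0 : E d) B := by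
    rintro _ ⟨w, hw, rfl⟩
    have e : AffineMap.homothety θh a w = (1 - a) • θh + a • w := by
      rw [AffineMap.homothety_apply]
      simp only [vsub_eq_sub, vadd_eq_add, smul_sub, sub_smul, one_smul]
      abel
    rw [e]
    exact convex_closedBall (0 : E d) B (by simpa using hh.1) hw (by linarith) ha0 (by ring)
  have hms : MeasurableSet s := by
    refine (IsCompact.image (isCompact_closedBall _ _) ?_).isClosed.measurableSet
    exact AffineMap.continuous_of_finiteDimensional _
  have hvol : volume s = ENNReal.ofReal (a ^ d) * volume (Metric.closedBall (0 : E d) B) := by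
    rw [hsdef, Measure.addHaar_image_homothety, abs_of_nonneg (by positivity)]
    simp
  rw [ENNReal.ofReal_mul (Real.exp_pos _).le, mul_assoc, ← hvol, ← setLIntegral_const]
  refine (setLIntegral_mono_ae' hms (ae_of_all _ ?_)).trans
    (lintegral_mono_set hsub)
  rintro _ ⟨w, hw, rfl⟩
  exact ENNReal.ofReal_le_ofReal (Real.exp_le_exp.2
    (ratioExponent_ge hs hx hR hh ha0 ha (by simpa using hw)))

/-- Confidence bound for all constrained maximum likelihood estimators of a fixed design. -/
lemma labelLaw_isMLE_ge {θs : E d} {x : Fin T → E d} (hs : ‖θs‖ ≤ B) (hx : ∀ i, ‖x i‖ ≤ R)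
    (hR : 0 ≤ R) {δ : ℝ} (hδ : 0 < δ) (hδ1 : δ ≤ 1) :
    ENNReal.ofReal (1 - δ) ≤ labelLaw θs x {y | ∀ θ, IsMLE B (fun i => (x i, y i)) θ →
      ∑ i, (inner ℝ (θ - θs) (x i)) ^ 2
        ≤ 16 * kappa d B R * (1 + d * Real.log (1 + 2 * B * R * T) + Real.log (1 / δ))} := by
  have hB : 0 ≤ B := (norm_nonneg _).trans hs
  have hk : 4 ≤ kappa d B R := four_le_kappa hB hR
  have hlogδ : 0 ≤ Real.log (1 / δ) := Real.log_nonneg (by rwa [le_div_iff₀ hδ, one_mul])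
  have hlogT : 0 ≤ Real.log (1 + 2 * B * R * T) := Real.log_nonneg (by
    have : 0 ≤ 2 * B * R * T := by positivity
    linarith)
  -- For `B = 0` the ball may have volume zero and the mixture carries no information, but then both
  -- parameters vanish.
  rcases hB.eq_or_lt with rfl | hBpos
  · have e : {y : Fin T → Bool | ∀ θ, IsMLE 0 (fun i => (x i, y i)) θ →
        ∑ i, (inner ℝ (θ - θs) (x i)) ^ 2
        ≤ 16 * kappa d 0 R * (1 + d * Real.log (1 + 2 * 0 * R * T) + Real.log (1 / δ))}
        = Set.univ := by
      refine Set.eq_univ_of_forall fun y θ hθ => ?_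
      have h1 : θ = 0 := norm_le_zero_iff.1 hθ.1
      have h2 : θs = 0 := norm_le_zero_iff.1 hs
      rw [h1, h2]
      simp only [sub_zero, inner_zero_left, ne_eq, OfNat.ofNat_ne_zero, not_false_eq_true,
        zero_pow, Finset.sum_const_zero]
      positivity
    rw [e, measure_univ]
    exact ENNReal.ofReal_le_one.2 (by linarith)
  set k := kappa d B R
  set vol := volume (Metric.closedBall (0 : E d) B)
  have hv0 : vol ≠ 0 := (Metric.measure_closedBall_pos volume _ hBpos).ne'
  have hvt : vol ≠ ∞ := measure_closedBall_lt_top.ne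
  -- This event does not involve the estimator, so the bound holds for all minimizers at once,
  -- however they are selected.
  set bad : Set (Fin T → Bool) := {y | vol / ENNReal.ofReal δ ≤ ratioMixture B k θs x y}
  have hbad : labelLaw θs x bad ≤ ENNReal.ofReal δ := by
    have hδ0 : ENNReal.ofReal δ ≠ 0 := (ENNReal.ofReal_pos.2 hδ).ne'
    refine (meas_ge_le_lintegral_div (measurable_of_finite _).aemeasurable
      (ENNReal.div_ne_zero.2 ⟨hv0, ENNReal.ofReal_ne_top⟩)
      (ENNReal.div_ne_top hvt hδ0)).trans ?_
    refine (ENNReal.div_le_div_right (lintegral_ratioMixture_le hs hx) _).trans (le_of_eq ?_)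
    rw [ENNReal.div_eq_inv_mul, ENNReal.inv_div (Or.inl ENNReal.ofReal_ne_top) (Or.inl hδ0)]
    exact ENNReal.div_mul_cancel hv0 hvt
  have hbm : MeasurableSet bad := bad.toFinite.measurableSet
  have hgood : ENNReal.ofReal (1 - δ) ≤ labelLaw θs x badᶜ := by
    rw [ENNReal.ofReal_sub _ hδ.le, ENNReal.ofReal_one, tsub_le_iff_right,
      ← prob_add_prob_compl hbm (μ := labelLaw θs x), add_comm]
    gcongr
  refine hgood.trans (measure_mono fun y hy θ hθ => ?_)
  -- Small enough for a log-likelihood loss of at most `1`; its price is the term `d log(1 + 2BRT)`.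
  set a : ℝ := (1 + 2 * B * R * T)⁻¹ with ha
  have hden : (1 : ℝ) ≤ 1 + 2 * B * R * T := by
    have : 0 ≤ 2 * B * R * T := by positivity
    linarith
  have ha0 : 0 < a := by positivity
  have ha1 : a ≤ 1 := inv_le_one_of_one_le₀ hden
  have haT : T * (2 * B * R * a) ≤ 1 := by
    rw [ha]
    have : T * (2 * B * R * (1 + 2 * B * R * T)⁻¹) = (2 * B * R * T) / (1 + 2 * B * R * T) := by
      ring
    rw [this, div_le_one (by linarith)]
    linarith
  have h1 := ratioMixture_ge hs hx hR hθ ha0.le ha1 haT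
  have h2 : ratioMixture B k θs x y < vol / ENNReal.ofReal δ := not_le.1 hy
  have h3 := h1.trans_lt h2
  rw [ENNReal.div_eq_inv_mul, ← ENNReal.ofReal_inv_of_pos hδ,
    ENNReal.mul_lt_mul_iff_left hv0 hvt, ENNReal.ofReal_lt_ofReal_iff (by positivity)] at h3
  change Real.exp (_ / (16 * k) - 1) * a ^ d < _ at h3
  rw [← lt_div_iff₀ (by positivity), ← Real.lt_log_iff_exp_lt (by positivity), ha, inv_pow,
    div_inv_eq_mul, Real.log_mul (by positivity) (by positivity), Real.log_pow, ← one_div] at h3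
  have h4 : (∑ i, (inner ℝ (θ - θs) (x i)) ^ 2) / (16 * k)
      ≤ 1 + d * Real.log (1 + 2 * B * R * T) + Real.log (1 / δ) := by linarith
  rwa [div_le_iff₀' (by positivity)] at h4

end Confidence

/-! ### From exploration and estimation to the returned policy. -/

section Output

variable {S A Pol : Type*} [MeasurableSpace S] [MeasurableSpace A] [MeasurableSpace Pol] {d : ℕ}
  (M : FeatureMDP S A d) {lam B L : ℝ}
  (pol : Kernel (Pol × S) A) [IsMarkovKernel pol]
  (oracle : ℝ → ℝ → Kernel (E d) Pol) [∀ ε δ, IsMarkovKernel (oracle ε δ)]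

/-- Chaining the success probabilities of exploration, estimation and planning. -/
lemma outputLaw_ge {θs : E d} {p₀ : Pol} {T : ℕ} {δ : ℝ}
    {mle : Kernel (Fin T → E d × Bool) (E d)} [IsMarkovKernel mle] {s : Set Pol}
    (hs : MeasurableSet s) {c : ℝ≥0∞} {G : Set (Buffer S A T)} (hG : MeasurableSet G)
    (hGc : c ≤ (exploreLaw M pol oracle lam (1 / √T) (δ / 5 / T) p₀ T).map Prod.snd G)
    (Y : Buffer S A T → Set (Fin T → Bool))
    (hY : ∀ b ∈ G, c ≤ preferenceBatch M θs T b (Y b))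
    (hmle : ∀ b ∈ G, ∀ y ∈ Y b, ∀ᵐ θ ∂(mle (toDataset M (b, y))),
      c ≤ oracle (1 / √T) (δ / 5) θ s) :
    c * c * c ≤ outputLaw M pol oracle θs lam p₀ T δ mle s := by
  set μ := (exploreLaw M pol oracle lam (1 / √T) (δ / 5 / T) p₀ T).map Prod.snd with hμ
  have : IsProbabilityMeasure μ := Measure.isProbabilityMeasure_map measurable_snd.aemeasurable
  have hm1 : Measurable fun θ => oracle (1 / √T) (δ / 5) θ s := Kernel.measurable_coe _ hs
  have hm2 : Measurable fun D => ∫⁻ θ, oracle (1 / √T) (δ / 5) θ s ∂(mle D) :=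
    hm1.lintegral_kernel
  have hm3 : Measurable fun q : Buffer S A T × (Fin T → Bool) =>
      ∫⁻ θ, oracle (1 / √T) (δ / 5) θ s ∂(mle (toDataset M q)) :=
    hm2.comp (measurable_toDataset M)
  rw [outputLaw, Measure.bind_apply hs (Kernel.aemeasurable _),
    Measure.lintegral_bind (Kernel.aemeasurable _) hm1.aemeasurable, datasetLaw,
    lintegral_map hm2 (measurable_toDataset M),
    Measure.lintegral_compProd hm3, ← hμ]
  calc c * c * c ≤ ∫⁻ _ in G, c * c ∂μ := by
        rw [setLIntegral_const]; gcongr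
    _ ≤ ∫⁻ b in G, ∫⁻ y, ∫⁻ θ, oracle (1 / √T) (δ / 5) θ s ∂(mle (toDataset M (b, y)))
          ∂(preferenceBatch M θs T b) ∂μ := by
        refine setLIntegral_mono' hG fun b hb => ?_
        have hYm : MeasurableSet (Y b) := (Y b).toFinite.measurableSet
        calc c * c ≤ ∫⁻ _ in Y b, c ∂(preferenceBatch M θs T b) := by
              rw [setLIntegral_const]; gcongr; exact hY b hb
          _ ≤ ∫⁻ y in Y b, ∫⁻ θ, oracle (1 / √T) (δ / 5) θ s ∂(mle (toDataset M (b, y)))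
                ∂(preferenceBatch M θs T b) := by
              refine setLIntegral_mono' hYm fun y hy => ?_
              calc c = ∫⁻ _, c ∂(mle (toDataset M (b, y))) := by simp
                _ ≤ _ := lintegral_mono_ae (hmle b hb y hy)
          _ ≤ _ := setLIntegral_le_lintegral _ _
    _ ≤ _ := setLIntegral_le_lintegral _ _

lemma preferenceBatch_eq_labelLaw (θs : E d) {T : ℕ} (b : Buffer S A T) :
    preferenceBatch M θs T b = labelLaw θs fun i => designPoint M (b i) := rfl

/-- Suboptimality of a policy that is nearly optimal for an estimated parameter. -/
lemma subOpt_le_of_estimate (hl : 0 < lam) (hL : ∀ s a, ‖M.φ (s, a)‖ ≤ L) {T : ℕ}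
    (b : Buffer S A T) {θs θh : E d} (hs : ‖θs‖ ≤ B) (hh : ‖θh‖ ≤ B) {g w ε : ℝ}
    (hg : ∑ i, (inner ℝ (θh - θs) (designPoint M (b i))) ^ 2 ≤ g)
    (hw : ∀ π₁ π₂ : Policy S A,
      √(qf (designMatrix M lam b) (M.meanFeature π₁ - M.meanFeature π₂)) ≤ w)
    {π : Policy S A} (hπ : M.subOpt θh π ≤ ε) :
    M.subOpt θs π ≤ √(g + 4 * (lam * B ^ 2)) * w + ε := by
  refine M.subOpt_le_of_forall hL _ _ fun π' => ?_
  set u := M.meanFeature π' - M.meanFeature π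
  have e : inner ℝ θs u = inner ℝ (θs - θh) u + inner ℝ θh u := by
    rw [← inner_add_left]; simp
  have h1 := (M.inner_sub_le_subOpt hL θh π π').trans hπ
  have h2 := inner_le_sqrt_mul_sqrt (posDef_designMatrix M hl b) (θs - θh) u
  -- The data part of the `V`-norm is the estimation error `g`; the regularizer contributes at most
  -- `lam * (2B)²`.
  have h3 : (θs - θh).ofLp ⬝ᵥ (designMatrix M lam b *ᵥ (θs - θh).ofLp)
      ≤ g + 4 * (lam * B ^ 2) := by
    rw [quadratic_designMatrix]
    have hn : ‖θs - θh‖ ≤ 2 * B := (norm_sub_le _ _).trans (by linarith)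
    have hn2 : ‖θs - θh‖ ^ 2 ≤ (2 * B) ^ 2 := pow_le_pow_left₀ (norm_nonneg _) hn 2
    have hsum : ∑ k, (inner ℝ (designPoint M (b k)) (θs - θh)) ^ 2
        = ∑ i, (inner ℝ (θh - θs) (designPoint M (b i))) ^ 2 := by
      refine Finset.sum_congr rfl fun i _ => ?_
      rw [real_inner_comm, ← neg_sub θh θs, inner_neg_left, neg_sq]
    rw [hsum]
    nlinarith
  rw [e]
  refine add_le_add (h2.trans ?_) h1
  exact mul_le_mul (Real.sqrt_le_sqrt h3) (hw π' π) (Real.sqrt_nonneg _) (Real.sqrt_nonneg _)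

end Output

/-! ### Numerical bounds for the width, the radius and the sample size. -/

section Numerics

variable {d : ℕ} {T δ R : ℝ}

lemma one_le_logPlus (x : ℝ) : 1 ≤ logPlus x := le_max_left _ _

lemma log_le_logPlus (hd : 1 ≤ d) (hT : 1 ≤ T) (hδ : 0 < δ) (hδ1 : δ < 1) :
    Real.log T ≤ logPlus (d * T / δ) ∧ Real.log (1 / (δ / 5)) ≤ 3 * logPlus (d * T / δ) := by
  have hd' : (1 : ℝ) ≤ d := by exact_mod_cast hd
  have h1 : T ≤ d * T / δ := by
    rw [le_div_iff₀ hδ]; nlinarith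
  have h2 : 1 / δ ≤ d * T / δ := by gcongr; nlinarith
  have hl1 := Real.log_le_log (by linarith) h1
  have hl2 := Real.log_le_log (by positivity) h2
  have hm : Real.log (d * T / δ) ≤ logPlus (d * T / δ) := le_max_right _ _
  refine ⟨hl1.trans hm, ?_⟩
  have e : 1 / (δ / 5) = 5 * (1 / δ) := by field_simp
  have h5 : Real.log 5 ≤ 2 := by
    rw [Real.log_le_iff_le_exp (by norm_num)]
    have h := Real.exp_one_gt_d9
    have : Real.exp 2 = Real.exp 1 * Real.exp 1 := by rw [← Real.exp_add]; norm_num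
    rw [this]
    nlinarith
  rw [e, Real.log_mul (by norm_num) (by positivity)]
  linarith [one_le_logPlus (d * T / δ)]

/-- The width bound after exploration. -/
lemma width_bound (hd : 1 ≤ d) (hT : 1 ≤ T) (hδ : 0 < δ) (hδ1 : δ < 1) (hR : 0 ≤ R) {α w : ℝ}
    (hα : α = √((1 + R ^ 2) * (Real.log (1 / (δ / 5)) + d * Real.log (1 + T * R ^ 2)) / (d * T)))
    (h : T * gainRate d R (1 / √T) (δ / 5 / T) α w
      ≤ Real.log (1 / (δ / 5)) + d * Real.log (1 + T * R ^ 2)) :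
    w ≤ 6 / absMoment * (d * (1 + R)
      * (√(logPlus (d * T / δ) * (1 + Real.log (1 + R))) * (1 / √T))) := by
  have hd' : (1 : ℝ) ≤ d := by exact_mod_cast hd
  have hc := absMoment_pos
  obtain ⟨hlT, hlδ⟩ := log_le_logPlus hd hT hδ hδ1
  set ℓ := logPlus (d * T / δ)
  have hℓ : 1 ≤ ℓ := one_le_logPlus _
  have hlR : 0 ≤ Real.log (1 + R) := Real.log_nonneg (by linarith)
  set s := 1 + Real.log (1 + R) with hsdef
  have hs : 1 ≤ s := by linarith
  have hlδ0 : 0 < Real.log (1 / (δ / 5)) := Real.log_pos (by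
    rw [lt_div_iff₀ (by positivity)]; linarith)
  have hlR2 : 0 ≤ Real.log (1 + T * R ^ 2) := Real.log_nonneg (by
    have : 0 ≤ T * R ^ 2 := by positivity
    linarith)
  set Q := Real.log (1 / (δ / 5)) + d * Real.log (1 + T * R ^ 2) with hQ
  have hQ0 : 0 < Q := by positivity
  have hlog : Real.log (1 + T * R ^ 2) ≤ ℓ + 2 * Real.log (1 + R) := by
    have h1 : 1 + T * R ^ 2 ≤ T * (1 + R) ^ 2 := by nlinarith [mul_nonneg (by linarith : 0 ≤ T) hR]
    have h2 := Real.log_le_log (by positivity) h1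
    rw [Real.log_mul (by positivity) (by positivity), Real.log_pow] at h2
    push_cast at h2
    linarith
  have hQle : Q ≤ 4 * d * (ℓ * s) := by
    have h1 : d * Real.log (1 + T * R ^ 2) ≤ d * (ℓ + 2 * Real.log (1 + R)) := by gcongr
    have h2 : Real.log (1 + R) ≤ ℓ * Real.log (1 + R) := le_mul_of_one_le_left hlR hℓ
    have h3 : ℓ ≤ d * ℓ := le_mul_of_one_le_left (by linarith) hd'
    have h4 : d * Real.log (1 + R) ≤ d * (ℓ * Real.log (1 + R)) := by gcongr
    have h5 : 0 ≤ d * (ℓ * Real.log (1 + R)) := by positivity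
    have e : 4 * d * (ℓ * s) = 4 * (d * ℓ) + 4 * (d * (ℓ * Real.log (1 + R))) := by
      rw [hsdef]; ring
    rw [e]
    linarith
  have hα0 : 0 < α := by rw [hα]; positivity
  have hαsq : α ^ 2 = (1 + R ^ 2) * Q / (d * T) := by rw [hα, Real.sq_sqrt (by positivity)]
  set τ := 1 / √T with hτ
  have hsT : 1 ≤ √T := Real.one_le_sqrt.2 hT
  have hτ0 : 0 < τ := by positivity
  have hτsq : τ ^ 2 = 1 / T := by rw [hτ, div_pow, Real.sq_sqrt (by linarith), one_pow]
  set r := √(ℓ * s)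
  have hrsq : r ^ 2 = ℓ * s := Real.sq_sqrt (by positivity)
  have hr1 : 1 ≤ r := Real.one_le_sqrt.2 (by nlinarith)
  have hαle : α ≤ 2 * ((1 + R) * (r * τ)) := by
    refine le_of_sq_le_sq ?_ (by positivity)
    rw [hαsq, mul_pow, mul_pow, mul_pow, hrsq, hτsq, div_le_iff₀ (by positivity)]
    have h1 : 1 + R ^ 2 ≤ (1 + R) ^ 2 := by nlinarith
    calc (1 + R ^ 2) * Q ≤ (1 + R) ^ 2 * (4 * d * (ℓ * s)) := by gcongr
      _ = _ := by field_simp; ring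
  -- The choice of `α` makes `T · α/(1 + R²) · (dα) = Q`. So the bracket in `gainRate` is at most
  -- `dα`, balancing it against the Gaussian cost `αd`.
  have hgain : absMoment * w ≤ 2 * (τ + √d * R * (δ / 5 / T)) + 2 * (α * d) := by
    rw [gainRate] at h
    have h1 : absMoment * w - 2 * (τ + √d * R * (δ / 5 / T)) - α * d ≤ d * α := by
      by_contra hcon
      push Not at hcon
      have h2 : T * (α / (1 + R ^ 2) * (d * α)) < Q := lt_of_lt_of_le (by gcongr) h
      have h3 : T * (α / (1 + R ^ 2) * (d * α)) = Q := by
        have : T * (α / (1 + R ^ 2) * (d * α)) = T * d * α ^ 2 / (1 + R ^ 2) := by ring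
        rw [this, hαsq]
        field_simp
      linarith
    linarith
  have hε : τ + √d * R * (δ / 5 / T) ≤ d * (1 + R) * (r * τ) := by
    have h1 : δ / 5 / T ≤ τ := by
      rw [hτ]
      refine div_le_div₀ (by norm_num) (by linarith) (by positivity) ?_
      exact Real.sqrt_le_iff.2 ⟨by linarith, by nlinarith⟩
    have h2 : √(d : ℝ) ≤ d := Real.sqrt_le_iff.2 ⟨by linarith, by nlinarith⟩
    have h3 : √d * R * (δ / 5 / T) ≤ d * R * τ := by gcongr
    have h4 : τ ≤ d * τ := le_mul_of_one_le_left hτ0.le hd'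
    have h5 : d * (1 + R) * τ ≤ d * (1 + R) * (r * τ) := by
      gcongr; exact le_mul_of_one_le_left hτ0.le hr1
    linarith
  have hfin : absMoment * w ≤ 6 * (d * (1 + R) * (r * τ)) := by
    have h1 : α * d ≤ 2 * ((1 + R) * (r * τ)) * d := by gcongr
    linarith
  rw [div_mul_eq_mul_div, le_div_iff₀ hc]
  linarith

/-- The radius of the confidence ellipsoid. -/
lemma radius_bound (hd : 1 ≤ d) (hT : 1 ≤ T) (hδ : 0 < δ) (hδ1 : δ < 1) (hR : 0 ≤ R) {k b : ℝ}
    (hk : 4 ≤ k) (hb : 0 ≤ b) :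
    √(16 * k * (1 + d * Real.log (1 + 2 * (b * R) * T) + Real.log (1 / (δ / 5))) + 4 * b ^ 2)
      ≤ 9 * ((1 + b) * (√(k * d) * √(logPlus (d * T / δ) * (1 + Real.log (1 + R))))) := by
  have hd' : (1 : ℝ) ≤ d := by exact_mod_cast hd
  obtain ⟨hlT, hlδ⟩ := log_le_logPlus hd hT hδ hδ1
  set ℓ := logPlus (d * T / δ)
  have hℓ : 1 ≤ ℓ := one_le_logPlus _
  have hlR : 0 ≤ Real.log (1 + R) := Real.log_nonneg (by linarith)
  have hlog : Real.log (1 + 2 * (b * R) * T) ≤ ℓ + 2 * b + Real.log (1 + R) := by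
    have h1 : 1 + 2 * (b * R) * T ≤ T * ((1 + 2 * b) * (1 + R)) := by
      have : 0 ≤ T * (2 * b + R) := by positivity
      nlinarith
    have h2 := Real.log_le_log (by positivity) h1
    rw [Real.log_mul (by positivity) (by positivity),
      Real.log_mul (by positivity) (by positivity)] at h2
    have h3 := Real.log_le_sub_one_of_pos (show 0 < 1 + 2 * b by positivity)
    linarith
  set v := Real.log (1 + R)
  refine Real.sqrt_le_iff.2 ⟨by positivity, ?_⟩
  rw [mul_pow, mul_pow, mul_pow, Real.sq_sqrt (by positivity), Real.sq_sqrt (by positivity)]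
  have hdl : 1 ≤ d * ℓ := by nlinarith
  have h1 : 1 + d * Real.log (1 + 2 * (b * R) * T) + Real.log (1 / (δ / 5))
      ≤ d * ℓ * (5 + 2 * b + v) := by
    have e1 : d * Real.log (1 + 2 * (b * R) * T) ≤ d * (ℓ + 2 * b + v) := by gcongr
    have e2 : d * (2 * b + v) ≤ d * ℓ * (2 * b + v) := by
      gcongr
      exact le_mul_of_one_le_right (by linarith) hℓ
    have e3 : ℓ ≤ d * ℓ := le_mul_of_one_le_left (by linarith) hd'
    linarith
  have h2 : 4 * b ^ 2 ≤ 16 * k * (d * ℓ * b ^ 2) := by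
    have : b ^ 2 ≤ d * ℓ * b ^ 2 := le_mul_of_one_le_left (sq_nonneg b) hdl
    have h' : d * ℓ * b ^ 2 ≤ k * (d * ℓ * b ^ 2) :=
      le_mul_of_one_le_left (by positivity) (by linarith)
    have : 0 ≤ d * ℓ * b ^ 2 := by positivity
    nlinarith
  calc 16 * k * (1 + d * Real.log (1 + 2 * (b * R) * T) + Real.log (1 / (δ / 5))) + 4 * b ^ 2
      ≤ 16 * k * (d * ℓ * (5 + 2 * b + v)) + 16 * k * (d * ℓ * b ^ 2) := by gcongr
    _ = 16 * (k * d * ℓ) * (5 + 2 * b + v + b ^ 2) := by ring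
    -- The resulting `16 · 5 = 80` is below `9² = 81`.
    _ ≤ 16 * (k * d * ℓ) * (5 * ((1 + b) ^ 2 * (1 + v))) := by
        gcongr
        have : 0 ≤ v * (2 * b + b ^ 2) := by positivity
        nlinarith
    _ = 80 * ((1 + b) ^ 2 * (k * d * (ℓ * (1 + v)))) := by ring
    _ ≤ _ := by
        have : 0 ≤ (1 + b) ^ 2 * (k * d * (ℓ * (1 + v))) := by positivity
        linarith

/-- Radius times width: `√(κd) · d/√T` accounts for `d³`, and the constant is `216 = 9 · 6 · 4`. The
summand `1` in the constant absorbs the final oracle error `1/√T`. -/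
lemma rate_bound (hd : 1 ≤ d) (hT : 1 ≤ T) {k b ℓ : ℝ} (hR : 0 ≤ R)
    (hk : 4 ≤ k) (hb : 0 ≤ b) (hℓ : 1 ≤ ℓ) :
    9 * ((1 + b) * (√(k * d) * √(ℓ * (1 + Real.log (1 + R)))))
        * (6 / absMoment * (d * (1 + R) * (√(ℓ * (1 + Real.log (1 + R))) * (1 / √T))))
        + 1 / √T
      ≤ (216 / absMoment + 1) * ((1 + b) * (1 + R / 2) ^ 2) * √(k * d ^ 3 / T * ℓ ^ 3) := by
  have hd' : (1 : ℝ) ≤ d := by exact_mod_cast hd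
  have hc := absMoment_pos
  have hlR : 0 ≤ Real.log (1 + R) := Real.log_nonneg (by linarith)
  have hs : 1 + Real.log (1 + R) ≤ 1 + R := by
    linarith [Real.log_le_sub_one_of_pos (show 0 < 1 + R by linarith)]
  set s := 1 + Real.log (1 + R)
  have hs0 : 1 ≤ s := by linarith
  have hr : √(ℓ * s) * √(ℓ * s) = ℓ * s := Real.mul_self_sqrt (by positivity)
  -- The argument itself produces only `ℓ²` under the root; `ℓ ≥ 1` relaxes it to the cube.
  have htarget : √(k * d) * (d * ℓ) * (1 / √T) ≤ √(k * d ^ 3 / T * ℓ ^ 3) := by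
    refine Real.le_sqrt_of_sq_le ?_
    rw [mul_pow, mul_pow, Real.sq_sqrt (by positivity), div_pow, Real.sq_sqrt (by linarith)]
    have : ℓ ^ 2 ≤ ℓ ^ 3 := pow_le_pow_right₀ hℓ (by norm_num)
    calc k * d * (d * ℓ) ^ 2 * (1 ^ 2 / T) = k * d ^ 3 / T * ℓ ^ 2 := by ring
      _ ≤ _ := by gcongr
  set Z := √(k * d ^ 3 / T * ℓ ^ 3)
  have hsT : 1 ≤ √T := Real.one_le_sqrt.2 hT
  have hkd : 1 ≤ √(k * d) := Real.one_le_sqrt.2 (by nlinarith)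
  -- Since `s ≤ 1 + R`. The half appears because `R = 2LH/√λ`, whereas the problem factor has
  -- `LH/√λ`.
  have hW : (1 + R) * s ≤ 4 * (1 + R / 2) ^ 2 := by nlinarith
  have hmain : 9 * ((1 + b) * (√(k * d) * √(ℓ * s)))
        * (6 / absMoment * (d * (1 + R) * (√(ℓ * s) * (1 / √T))))
      ≤ 216 / absMoment * ((1 + b) * (1 + R / 2) ^ 2) * Z := by
    calc 9 * ((1 + b) * (√(k * d) * √(ℓ * s)))
          * (6 / absMoment * (d * (1 + R) * (√(ℓ * s) * (1 / √T))))
        = 54 / absMoment * (1 + b) * (1 + R) * (√(k * d) * d * (1 / √T))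
            * (√(ℓ * s) * √(ℓ * s)) := by ring
      _ = 54 / absMoment * (1 + b) * ((1 + R) * s) * (√(k * d) * (d * ℓ) * (1 / √T)) := by
          rw [hr]; ring
      _ ≤ 54 / absMoment * (1 + b) * (4 * (1 + R / 2) ^ 2) * Z := by gcongr
      _ = _ := by ring
  have hε : 1 / √T ≤ (1 + b) * (1 + R / 2) ^ 2 * Z := by
    have h1 : 1 / √T ≤ Z := by
      refine le_trans ?_ htarget
      refine le_mul_of_one_le_left (by positivity) ?_
      nlinarith [mul_le_mul hd' hℓ zero_le_one (by linarith : (0 : ℝ) ≤ d)]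
    have h2 : 1 ≤ (1 + b) * (1 + R / 2) ^ 2 := by nlinarith [mul_nonneg hb (sq_nonneg (1 + R / 2))]
    exact h1.trans (le_mul_of_one_le_left (Real.sqrt_nonneg _) h2)
  linarith

/-- Inversion of the rate: the number of iterations for a given accuracy. -/
lemma sample_size_bound (hd : 1 ≤ d) (hδ : 0 < δ) {c N : ℝ} (hc : 0 < c)
    (hN : 0 < N) (hT : 0 < T)
    (h : (1728 * c ^ 2 + c + 1) ^ 2 * N * logPlus (d * N / δ) ^ 3 ≤ T) :
    c ^ 2 * N * logPlus (d * T / δ) ^ 3 ≤ T := by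
  have hd' : (1 : ℝ) ≤ d := by exact_mod_cast hd
  set ℓ := logPlus (d * N / δ) with hℓdef
  have hℓ : 1 ≤ ℓ := one_le_logPlus _
  set a := 1728 * c ^ 2 + c + 1 with ha
  have ha1 : 1 ≤ a := by rw [ha]; nlinarith [sq_nonneg c]
  set r := T / N with hr
  have hr0 : 0 < r := by positivity
  have hrT : T = r * N := by rw [hr]; field_simp
  have hra : a ^ 2 * ℓ ^ 3 ≤ r := by
    rw [hr, le_div_iff₀ hN]; linarith
  have hℓ3 : 1 ≤ ℓ ^ 3 := one_le_pow₀ hℓ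
  have har : a ^ 2 ≤ r := (le_mul_of_one_le_right (by positivity) hℓ3).trans hra
  have hr1 : 1 ≤ r := (one_le_pow₀ ha1).trans har
  have hv0 : 0 ≤ Real.log r := Real.log_nonneg hr1
  have hlog : logPlus (d * T / δ) ≤ ℓ + Real.log r := by
    refine max_le (by linarith) ?_
    have e : d * T / δ = d * N / δ * r := by rw [hrT]; ring
    rw [e, Real.log_mul (by positivity) (by positivity)]
    have : Real.log (d * N / δ) ≤ ℓ := le_max_right _ _
    linarith
  set v := Real.log r
  -- From `log r ≤ 6 r^{1/6}`, cubed. Here `r = T/N` is the oversampling ratio, and `log₊(dT/δ)`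
  -- exceeds `ℓ` by at most `log r`.
  have hv : v ^ 3 ≤ 216 * √r := by
    have h1 := Real.log_le_rpow_div hr0.le (show (0 : ℝ) < 1 / 6 by norm_num)
    have h2 : v ≤ 6 * r ^ (1 / 6 : ℝ) := by
      refine h1.trans (le_of_eq ?_); ring
    have h3 := pow_le_pow_left₀ hv0 h2 3
    have h4 : (r ^ (1 / 6 : ℝ)) ^ 3 = √r := by
      rw [← Real.rpow_natCast, ← Real.rpow_mul hr0.le, Real.sqrt_eq_rpow]
      norm_num
    rw [mul_pow, h4] at h3
    linarith
  have hsr : a ≤ √r := Real.le_sqrt_of_sq_le har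
  have hsq : √r * √r = r := Real.mul_self_sqrt hr0.le
  have hcube : (ℓ + v) ^ 3 ≤ 4 * (ℓ ^ 3 + v ^ 3) := by
    nlinarith [mul_nonneg (add_nonneg (by linarith : 0 ≤ ℓ) hv0) (sq_nonneg (ℓ - v))]
  -- Each of `4c²ℓ³` and `4 · 216 c²√r` must be at most `r/2`; the second requirement is the source
  -- of `1728`.
  have h1 : c ^ 2 * logPlus (d * T / δ) ^ 3 ≤ r := by
    have h2 : logPlus (d * T / δ) ^ 3 ≤ (ℓ + v) ^ 3 :=
      pow_le_pow_left₀ (by linarith [one_le_logPlus (d * T / δ)]) hlog 3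
    have h3 : 8 * c ^ 2 * ℓ ^ 3 ≤ r := by
      refine le_trans ?_ hra
      gcongr
      nlinarith [sq_nonneg c]
    have h4 : 1728 * c ^ 2 * √r ≤ r := by
      calc 1728 * c ^ 2 * √r ≤ √r * √r := by
            gcongr
            refine le_trans ?_ hsr
            rw [ha]; linarith
        _ = r := hsq
    have h5 : c ^ 2 * logPlus (d * T / δ) ^ 3 ≤ c ^ 2 * (4 * (ℓ ^ 3 + 216 * √r)) := by
      gcongr
      linarith
    linarith
  calc c ^ 2 * N * logPlus (d * T / δ) ^ 3 = (c ^ 2 * logPlus (d * T / δ) ^ 3) * N := by ring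
    _ ≤ r * N := by gcongr
    _ = T := hrT.symm

end Numerics

/-! ### Assembling the high-probability bound. -/

section Main

variable {S A Pol : Type*} [MeasurableSpace S] [MeasurableSpace A] [MeasurableSpace Pol] {d : ℕ}
  (M : FeatureMDP S A d) {lam B L : ℝ}
  (pol : Kernel (Pol × S) A) [IsMarkovKernel pol]
  (oracle : ℝ → ℝ → Kernel (E d) Pol) [∀ ε δ, IsMarkovKernel (oracle ε δ)]

/-- High-probability suboptimality bound for the output of RPO-Explore. -/
lemma outputLaw_subOpt_le_ge (hd : 1 ≤ d) {θs : E d} (hs : ‖θs‖ ≤ B)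
    (hL : ∀ s a, ‖M.φ (s, a)‖ ≤ L) (hO : IsPACOracle M pol oracle) (p₀ : Pol) (hl : 0 < lam)
    {δ : ℝ} (hδ : 0 < δ) (hδ1 : δ < 1) {T : ℕ} (hT : 1 ≤ T)
    (mle : Kernel (Fin T → E d × Bool) (E d)) [IsMarkovKernel mle]
    (hmle : ∀ D, ∀ᵐ θ ∂(mle D), IsMLE B D θ) :
    ENNReal.ofReal (1 - δ) ≤ outputLaw M pol oracle θs lam p₀ T δ mle
      {p | M.subOpt θs (polAt pol p) ≤ (216 / absMoment + 1) * problemFactor B L M.horizon lam *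
        √(kappa d B (2 * L * M.horizon) * (d : ℝ) ^ 3 / T * logPlus (d * T / δ) ^ 3)} := by
  have hL0 := M.nonneg_of_norm_le hL (polAt pol p₀)
  have hH := M.horizon_pos
  have hB : 0 ≤ B := (norm_nonneg _).trans hs
  have hT' : (1 : ℝ) ≤ T := by exact_mod_cast hT
  have hd' : (1 : ℝ) ≤ d := by exact_mod_cast hd
  have hsl : 0 < √lam := Real.sqrt_pos.2 hl
  set R := 2 * L * M.horizon / √lam with hRdef
  have hR : 0 ≤ R := by positivity
  have hX : 0 ≤ 2 * L * M.horizon := by positivity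
  set k := kappa d B (2 * L * M.horizon)
  have hk : 4 ≤ k := four_le_kappa hB hX
  set b₀ := √lam * B with hb₀
  have hb : 0 ≤ b₀ := by positivity
  set Q := Real.log (1 / (δ / 5)) + d * Real.log (1 + T * R ^ 2) with hQ
  have hQ0 : 0 < Q := by
    have h1 : 0 < Real.log (1 / (δ / 5)) := Real.log_pos (by
      rw [lt_div_iff₀ (by positivity)]; linarith)
    have h2 : 0 ≤ Real.log (1 + T * R ^ 2) := Real.log_nonneg (by
      have : 0 ≤ (T : ℝ) * R ^ 2 := by positivity
      linarith)
    positivity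
  set α := √((1 + R ^ 2) * Q / (d * T)) with hα
  have hα0 : 0 < α := by positivity
  have hε0 : 0 < 1 / √(T : ℝ) := by positivity
  have hδT : δ / 5 / T < 1 := by
    rw [div_lt_one (by positivity)]; linarith
  obtain ⟨G, hG, hGc, hGw⟩ := exists_explored_event M pol oracle hd hl hL hO hε0
    (show 0 < δ / 5 / T by positivity) hδT hα0 (show 0 < δ / 5 by positivity) p₀ T
  have hsm : MeasurableSet {p | M.subOpt θs (polAt pol p) ≤
      (216 / absMoment + 1) * problemFactor B L M.horizon lam *
        √(k * (d : ℝ) ^ 3 / T * logPlus (d * T / δ) ^ 3)} :=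
    measurable_subOpt M pol θs measurableSet_Iic
  -- Only three events can fail, each with probability at most `δ/5`: exploration, labels and the
  -- final oracle call. Oracle failures during exploration are already absorbed in expectation.
  have hc3 : ENNReal.ofReal (1 - δ)
      ≤ ENNReal.ofReal (1 - δ / 5) * ENNReal.ofReal (1 - δ / 5) * ENNReal.ofReal (1 - δ / 5) := by
    rw [← ENNReal.ofReal_mul (by linarith), ← ENNReal.ofReal_mul (by nlinarith)]
    refine ENNReal.ofReal_le_ofReal ?_
    nlinarith [mul_pos hδ hδ, mul_pos hδ (mul_pos hδ hδ)]
  refine hc3.trans (outputLaw_ge M pol oracle hsm hG hGc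
    (fun b => {y | ∀ θ, IsMLE B (fun i => (designPoint M (b i), y i)) θ →
      ∑ i, (inner ℝ (θ - θs) (designPoint M (b i))) ^ 2
        ≤ 16 * k * (1 + d * Real.log (1 + 2 * B * (2 * L * M.horizon) * T)
          + Real.log (1 / (δ / 5)))})
    (fun b _ => ?_) (fun b hbG y hy => ?_))
  · rw [preferenceBatch_eq_labelLaw]
    exact labelLaw_isMLE_ge hs (fun i => M.norm_designPoint_le hL (b i)) hX (by positivity)
      (by linarith)
  · filter_upwards [hmle (toDataset M (b, y))] with θ hθ
    refine (hO _ hε0 (δ / 5) (by positivity) (by linarith) θ).trans (measure_mono fun p hp => ?_)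
    have hw := fun π₁ π₂ => width_bound hd hT' hδ hδ1 hR hα (hGw b hbG π₁ π₂)
    refine (subOpt_le_of_estimate M hl hL b hs hθ.1 (hy θ hθ) hw hp).trans ?_
    have hrad := radius_bound (δ := δ) hd hT' hδ hδ1 hR hk hb
    have e1 : 2 * B * (2 * L * M.horizon) * T = 2 * (b₀ * R) * T := by
      rw [hb₀, hRdef]; field_simp
    have e2 : lam * B ^ 2 = b₀ ^ 2 := by rw [hb₀, mul_pow, Real.sq_sqrt hl.le]
    have e3 : problemFactor B L M.horizon lam = (1 + b₀) * (1 + R / 2) ^ 2 := by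
      rw [problemFactor, hRdef]
      congr 3
      ring
    rw [e1, e2, e3]
    refine le_trans ?_ (rate_bound hd hT' hR hk hb (one_le_logPlus (d * T / δ)))
    gcongr
    have hc := absMoment_pos
    have : 0 ≤ Real.log (1 + R) := Real.log_nonneg (by linarith)
    have := one_le_logPlus (d * T / δ)
    positivity

end Main

end

end RPO

theorem theorem2 :
    ∃ C : ℝ, 0 < C ∧
      ∀ (d : ℕ), 1 ≤ d →
      ∀ (S A Pol : Type*) [MeasurableSpace S] [MeasurableSpace A] [MeasurableSpace Pol]
        (M : RPO.FeatureMDP S A d) (θs : RPO.E d) (B L : ℝ),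
        ‖θs‖ ≤ B → (∀ s a, ‖M.φ (s, a)‖ ≤ L) →
      ∀ (pol : Kernel (Pol × S) A) [IsMarkovKernel pol]
        (oracle : ℝ → ℝ → Kernel (RPO.E d) Pol) [∀ ε δ, IsMarkovKernel (oracle ε δ)],
        RPO.IsPACOracle M pol oracle →
      ∀ (p₀ : Pol) (lam : ℝ), 0 < lam → ∀ (δ : ℝ), 0 < δ → δ < 1 → ∀ (T : ℕ), 1 ≤ T →
      ∀ (mle : Kernel (Fin T → RPO.E d × Bool) (RPO.E d)) [IsMarkovKernel mle],
        (∀ D, ∀ᵐ θ ∂(mle D), RPO.IsMLE B D θ) →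
        (ENNReal.ofReal (1 - δ) ≤ RPO.outputLaw M pol oracle θs lam p₀ T δ mle
          {p | M.subOpt θs (RPO.polAt pol p) ≤
            C * RPO.problemFactor B L M.horizon lam *
              √(RPO.kappa d B (2 * L * M.horizon) * (d : ℝ) ^ 3 / T *
                RPO.logPlus (d * T / δ) ^ 3)}) ∧
        (∀ η N : ℝ, 0 < η →
          N = RPO.problemFactor B L M.horizon lam ^ 2 *
            RPO.kappa d B (2 * L * M.horizon) * (d : ℝ) ^ 3 / η ^ 2 →
          C * N * RPO.logPlus (d * N / δ) ^ 3 ≤ T →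
          ENNReal.ofReal (1 - δ) ≤ RPO.outputLaw M pol oracle θs lam p₀ T δ mle
            {p | M.subOpt θs (RPO.polAt pol p) ≤ η}) := by
  have hc0 : 0 < 216 / RPO.absMoment + 1 := by
    have := RPO.absMoment_pos
    positivity
  obtain ⟨c, hc, hcdef⟩ : ∃ c : ℝ, 0 < c ∧ c = 216 / RPO.absMoment + 1 := ⟨_, hc0, rfl⟩
  -- One constant serves both claims: it is at least `c` for the rate, and it is the constant
  -- required by `sample_size_bound` for inverting the rate.
  refine ⟨(1728 * c ^ 2 + c + 1) ^ 2, by positivity, ?_⟩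
  intro d hd S A Pol _ _ _ M θs B L hs hL pol _ oracle _ hO p₀ lam hl δ hδ hδ1 T hT mle _ hmle
  have hmain := RPO.outputLaw_subOpt_le_ge M pol oracle hd hs hL hO p₀ hl hδ hδ1 hT mle hmle
  rw [← hcdef] at hmain
  have hL0 := M.nonneg_of_norm_le hL (RPO.polAt pol p₀)
  have hH := M.horizon_pos
  have hB : 0 ≤ B := (norm_nonneg _).trans hs
  have hk : 4 ≤ RPO.kappa d B (2 * L * M.horizon) := RPO.four_le_kappa hB (by positivity)
  have hsl : 0 < √lam := Real.sqrt_pos.2 hl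
  have hK : 0 < RPO.problemFactor B L M.horizon lam := by
    unfold RPO.problemFactor; positivity
  have hT' : (0 : ℝ) < T := by exact_mod_cast hT
  have hd' : (0 : ℝ) < d := by exact_mod_cast hd
  refine ⟨hmain.trans (measure_mono fun p hp => ?_), fun η N hη hN hTN => ?_⟩
  · simp only [Set.mem_ofPred_eq] at hp ⊢
    refine hp.trans ?_
    gcongr
    nlinarith [sq_nonneg c, sq_nonneg (1728 * c ^ 2 + c)]
  · have hN0 : 0 < N := by rw [hN]; positivity
    have h := RPO.sample_size_bound hd hδ hc hN0 hT' hTN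
    refine hmain.trans (measure_mono fun p hp => ?_)
    simp only [Set.mem_ofPred_eq] at hp ⊢
    refine hp.trans ?_
    rw [← abs_of_pos hη, ← Real.sqrt_sq_eq_abs]
    refine Real.le_sqrt_of_sq_le ?_
    have hℓ := RPO.one_le_logPlus (d * T / δ)
    rw [mul_pow, mul_pow, Real.sq_sqrt (by positivity)]
    rw [hN] at h
    -- Writes the squared rate as `η²` times `c² N log₊(dT/δ)³ / T`, which is at most `η²` by the
    -- sample size bound.
    rw [show c ^ 2 * RPO.problemFactor B L M.horizon lam ^ 2 *
        (RPO.kappa d B (2 * L * M.horizon) * (d : ℝ) ^ 3 / T * RPO.logPlus (d * T / δ) ^ 3)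
      = c ^ 2 * (RPO.problemFactor B L M.horizon lam ^ 2 *
        RPO.kappa d B (2 * L * M.horizon) * (d : ℝ) ^ 3 / η ^ 2) *
        RPO.logPlus (d * T / δ) ^ 3 / T * η ^ 2 by field_simp]
    refine mul_le_of_le_one_left (sq_nonneg η) ?_
    rwa [div_le_one hT']
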